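/- Let $\mathbb X=\mathbb R^{n\times m}$ with Frobenius inner product $\langle X,Y\rangle=\mathrm{Tr}(X^\top Y)$ and Frobenius norm $\|\cdot\|_F$. Let $\mathcal F:\mathbb X\to\mathbb R$ attain its minimum and be $L$-smooth (differentiable with $\|\nabla\mathcal F(Y)-\nabla\mathcal F(X)\|_F\le L\|Y-X\|_F$). Let $\mathcal K$ be a norm on $\mathbb X$, $\nabla\mathcal K$ a measurable selection of its subgradients, $\mathcal K^*(X)=\sup_Y(\langle X,Y\rangle-\mathcal K(Y))\in(-\infty,\infty]$ its convex conjugate, and $\nabla\mathcal K^*$ a selection of subgradients of $\mathcal K^*$ on $\{\mathcal K^*<\infty\}$. Let $0<\beta_1<\beta_2<1$, $\lambda>0$, $X_0,M_0\in\mathbb X$, $\theta_2\ge\theta_1>0$. For $\sigma\ge0$ and an integer $n_{\mathrm{batch}}\ge1$, let $\xi_0,\xi_1,\dots$ be i.i.d. samples from a distribution $\mathcal D$ and let $\mathcal F(X,\xi)$ be a sample loss, differentiable in $X$, measurable and integrable in $\xi$, with $\mathcal F(X)=\mathbb E_{\xi\sim\mathcal D}[\mathcal F(X,\xi)]$, such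 that for all $X$ $$\mathbb E_{\xi\sim\mathcal D}[\nabla\mathcal F(X,\xi)]=\nabla\mathcal F(X),\qquad \mathbb E_{\xi\sim\mathcal D}\big[\|\nabla\mathcal F(X,\xi)-\nabla\mathcal F(X)\|_F^2\big]\le\frac{\sigma^2}{n_{\mathrm{batch}}}.$$ Let $T\ge1$, let $\frac{\theta_1}{\sqrt T}\le\eta\le\frac{\theta_2}{\sqrt T}$ (that is, $\eta=\Theta(1/\sqrt T)$), and, from $X_0$, $M_0$, with $G_t=\nabla\mathcal F(X_t,\xi_t)$, let $$M_{t+1}=\beta_2M_t-(1-\beta_2)G_t,\quad \widetilde M_{t+1}=\beta_1M_t-(1-\beta_1)G_t,\quad X_{t+1}=X_t+\eta\big(\nabla\mathcal K(\widetilde M_{t+1})-\lambda X_{t+1}\big).\qquad(\ast)$$ Then there is a constant $C$, independent of $T$, $\eta$, $\sigma$, $n_{\mathrm{batch}}$, $\mathcal D$, the sample loss and the samples (it may depend on the data of the first paragraph), such that all expectations below are finite and the following hold. 1. If $\mathcal K^*(\lambda X_0)<\infty$ (that is, $\lambda X_0$ lies in the unit ball of the norm dual to $\mathcal K$), then $$\Big|\min_{1\le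 t\le T}\mathbb E\big[\langle\nabla\mathcal K(\widetilde M_t)-\lambda X_t,\ \widetilde M_t-\nabla\mathcal K^*(\lambda X_t)\rangle\big]\Big|\le C\Big(\frac1{\sqrt T}+\frac{\sigma}{\sqrt{n_{\mathrm{batch}}}}\Big).$$ 2. For every $X_0$, $$\Big|\min_{1\le t\le T}\mathbb E\big[\langle\nabla\mathcal K(\widetilde M_t)-\nabla\mathcal K(M_t),\ \widetilde M_t-M_t\rangle\big]\Big|\le C\Big(\frac1{\sqrt T}+\frac{\sigma}{\sqrt{n_{\mathrm{batch}}}}\Big).$$ 3. (Muon) If instead $\nabla\mathcal K$ in $(\ast)$ is replaced by the matrix sign $\mathrm{msgn}(X)=(XX^\top)^{-1/2}X$ (with the Moore–Penrose inverse of $(XX^\top)^{1/2}$), and if the spectral norm of $\lambda X_0$ is at most $1$, then $$\Big|\min_{1\le t\le T}\mathbb E[\mathcal S(X_t)]\Big|\le C\Big(\frac1{\sqrt T}+\frac{\sigma}{\sqrt{n_{\mathrm{batch}}}}\Big),\qquad \mathcal S(X)=\|\nabla\mathcal F(X)\|_{\mathrm{nuc}}+\langle\lambda X,\nabla\mathcal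 F(X)\rangle,$$ where $\|\cdot\|_{\mathrm{nuc}}$ is the nuclear norm (the sum of the singular values). -/

import Mathlib

open MeasureTheory ProbabilityTheory

namespace LionK

/-- The space of real `n × m` matrices with the Frobenius inner product
`⟪X, Y⟫ = ∑ i j, X i j * Y i j` and the Frobenius norm. -/
abbrev Mat (n m : ℕ) : Type := EuclideanSpace ℝ (Fin n × Fin m)

/-- The rectangular array of entries of `X`. -/
def toMatrix {n m : ℕ} (X : Mat n m) : Matrix (Fin n) (Fin m) ℝ :=
  Matrix.of fun i j => X (i, j)

/-- The point of `Mat n m` with the given array of entries. -/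
def ofMatrix {n m : ℕ} (A : Matrix (Fin n) (Fin m) ℝ) : Mat n m :=
  WithLp.toLp 2 fun p => A p.1 p.2

/-- The inner product of `Mat n m` is the Frobenius inner product `Tr (Xᵀ Y)`. -/
theorem inner_eq_trace {n m : ℕ} (X Y : Mat n m) :
    inner ℝ X Y = ((toMatrix X).transpose * toMatrix Y).trace := by
  simp only [PiLp.inner_apply, toMatrix, Matrix.trace, Matrix.diag, Matrix.mul_apply,
    Matrix.transpose_apply, Matrix.of_apply, Fintype.sum_prod_type]
  rw [Finset.sum_comm]
  refine Finset.sum_congr rfl fun j _ => Finset.sum_congr rfl fun i _ => ?_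
  simp [mul_comm]

/-- The singular values of `X` in decreasing order, indexed from `0`
(continued by zeros from index `min n m` on). -/
noncomputable def singularValue {n m : ℕ} (X : Mat n m) (i : ℕ) : ℝ :=
  (Matrix.toEuclideanLin (toMatrix X)).singularValues i

/-- The nuclear (trace) norm: the sum of the `min n m` singular values. -/
noncomputable def nuclearNorm {n m : ℕ} (X : Mat n m) : ℝ :=
  ∑ i ∈ Finset.range (min n m), singularValue X i

/-- The spectral norm: the largest singular value. -/
noncomputable def spectralNorm {n m : ℕ} (X : Mat n m) : ℝ :=
  singularValue X 0

/-- The matrix sign `(X Xᵀ)^(-1/2) X`. The function `x ↦ (√x)⁻¹` (with value `0` at `0`) is applied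
to the positive semidefinite matrix `X Xᵀ` spectrally, which gives the Moore–Penrose inverse of the
matrix square root. -/
noncomputable def msgn {n m : ℕ} (X : Mat n m) : Mat n m :=
  ofMatrix (cfc (fun x : ℝ => (Real.sqrt x)⁻¹) (toMatrix X * (toMatrix X).transpose) * toMatrix X)

/-- The convex conjugate `K⋆(X) = sup_Y (⟪X, Y⟫ - K(Y))`, with values in the extended reals. -/
noncomputable def conjugate {n m : ℕ} (K : Mat n m → ℝ) (X : Mat n m) : EReal :=
  ⨆ Y : Mat n m, ((inner ℝ X Y - K Y : ℝ) : EReal)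

/-- `G` is a subgradient at `X` of the extended-real-valued function `f`. -/
def IsSubgradient {n m : ℕ} (f : Mat n m → EReal) (X G : Mat n m) : Prop :=
  ∀ Y : Mat n m, f X + ((inner ℝ G (Y - X) : ℝ) : EReal) ≤ f Y

/-- `F` is `L`-smooth: differentiable with `L`-Lipschitz gradient. -/
def IsLSmooth {n m : ℕ} (F : Mat n m → ℝ) (L : ℝ) : Prop :=
  Differentiable ℝ F ∧ ∀ X Y : Mat n m, ‖gradient F Y - gradient F X‖ ≤ L * ‖Y - X‖

/-- The variance `E ‖Y - E Y‖²` of a matrix-valued random variable. -/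
noncomputable def variance {n m : ℕ} {Ξ : Type*} [MeasurableSpace Ξ] (Y : Ξ → Mat n m)
    (D : Measure Ξ) : ℝ :=
  ∫ x, ‖Y x - ∫ y, Y y ∂D‖ ^ 2 ∂D

/-- The stochastic gradient `∇F(X, ξ)`: the gradient in `X` of the sample loss `ℓ(X, ξ)`. -/
noncomputable def stochGrad {n m : ℕ} {Ξ : Type*} (ℓ : Mat n m → Ξ → ℝ) (X : Mat n m) (x : Ξ) :
    Mat n m :=
  gradient (fun Y => ℓ Y x) X

/-- The sample loss `ℓ` and the data distribution `D` represent the objective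
`F(X) = E_{ξ ∼ D} ℓ(X, ξ)`, and the stochastic gradient is an unbiased estimator of `∇F(X)` with
variance at most `v`, at every point `X`. -/
structure IsStochasticModel {n m : ℕ} (F : Mat n m → ℝ) {Ξ : Type*} [MeasurableSpace Ξ]
    (D : Measure Ξ) (ℓ : Mat n m → Ξ → ℝ) (v : ℝ) : Prop where
  measurable_loss : ∀ X, Measurable (ℓ X)
  differentiable_loss : ∀ x, Differentiable ℝ fun X => ℓ X x
  integrable_loss : ∀ X, Integrable (ℓ X) D
  objective_eq : ∀ X, F X = ∫ x, ℓ X x ∂D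
  memLp_grad : ∀ X, MemLp (stochGrad ℓ X) 2 D
  unbiased : ∀ X, ∫ x, stochGrad ℓ X x ∂D = gradient F X
  variance_le : ∀ X, variance (stochGrad ℓ X) D ≤ v

/-- The samples `ξ 0, ξ 1, …` are independent and identically distributed with law `D`. -/
structure IsIIDSample {Ω Ξ : Type*} [MeasurableSpace Ω] [MeasurableSpace Ξ] (P : Measure Ω)
    (D : Measure Ξ) (ξ : ℕ → Ω → Ξ) : Prop where
  measurable : ∀ t, Measurable (ξ t)
  indep : iIndepFun ξ P
  law : ∀ t, P.map (ξ t) = D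

/-- `X`, `M`, `M'` (the last one with values used at times `t ≥ 1` only) are generated by the
implicit update rule with gradient `G t = ∇F(X t, ξ t)` and constant learning rate `η`, started
at `X₀`, `M₀`:
`M (t+1) = β₂ M t - (1 - β₂) G t`, `M' (t+1) = β₁ M t - (1 - β₁) G t`,
`X (t+1) = X t + η (∇K (M' (t+1)) - lam X (t+1))`. -/
structure IsRun {n m : ℕ} {Ω Ξ : Type*} (gradK : Mat n m → Mat n m) (β₁ β₂ lam η : ℝ)
    (X₀ M₀ : Mat n m) (ℓ : Mat n m → Ξ → ℝ) (ξ : ℕ → Ω → Ξ) (X M M' : ℕ → Ω → Mat n m) :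
    Prop where
  init_X : ∀ ω, X 0 ω = X₀
  init_M : ∀ ω, M 0 ω = M₀
  step_M : ∀ t ω, M (t + 1) ω = β₂ • M t ω - (1 - β₂) • stochGrad ℓ (X t ω) (ξ t ω)
  step_M' : ∀ t ω, M' (t + 1) ω = β₁ • M t ω - (1 - β₁) • stochGrad ℓ (X t ω) (ξ t ω)
  step_X : ∀ t ω, X (t + 1) ω = X t ω + η • (gradK (M' (t + 1) ω) - lam • X (t + 1) ω)

/-- The KKT score `S(X) = ‖∇F(X)‖_nuc + ⟪lam X, ∇F(X)⟫`. -/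
noncomputable def kktScore {n m : ℕ} (F : Mat n m → ℝ) (lam : ℝ) (X : Mat n m) : ℝ :=
  nuclearNorm (gradient F X) + inner ℝ (lam • X) (gradient F X)

/-- The random variables `Q 1, …, Q T` have finite expectation and
`|min_{1 ≤ t ≤ T} E[Q t]| ≤ B`. -/
def MinExpectationBound {Ω : Type*} [MeasurableSpace Ω] (P : Measure Ω) (Q : ℕ → Ω → ℝ) (T : ℕ)
    (hT : 1 ≤ T) (B : ℝ) : Prop :=
  (∀ t ∈ Finset.Icc 1 T, Integrable (Q t) P) ∧
    |(Finset.Icc 1 T).inf' (Finset.nonempty_Icc.mpr hT) fun t => ∫ ω, Q t ω ∂P| ≤ B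

end LionK

namespace LionK

/-! Solving the implicit step gives `λX_{t+1}` as a convex combination of `λX_t` and the update
`∇K(M'_{t+1})`. Subgradients of a norm lie in its dual ball, so the iterates stay bounded for every
`η > 0`, and stay in the dual ball if started there. Hence `d_{t+1} = ∇K(M'_{t+1}) - λX_{t+1}` has
norm at most a constant `c`.

Smoothness bounds `η⟪d_{t+1}, M'_{t+1}⟫` by `F(X_t) - F(X_{t+1})`, plus `O(η²)`, plus `ηc` times the
distance of `M'_{t+1}` from `-∇F(X_t)` (`sum_inner_step_le`). The momentum error contracts by `β₂`
and is fed by noise and by the drift `O(η)` of the gradient, so its sum over `T` steps is `O(1 +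
Tη)` plus a multiple of the summed noise (`sum_momentum_error_le`). No averaging of noise is
exploited: a first moment of at most `σ/√nbatch` per step suffices, and it follows from the
independence of `X_t` and `ξ_t` (`lintegral_noise_comp_le`). Dividing by `T` with `η` of order
`1/√T` bounds the average of a nonnegative quantity, hence its minimum
(`minExpectationBound_of_sum_le`).

The three claims reduce to this. In the first, `∇K⋆(λX_{t+1})` is normal to the dual ball at a point
strictly inside a segment of the ball in direction `d_{t+1}`, so it is orthogonal to `d_{t+1}` and
drops out (`inner_implicit_step_sub_subgradient`). In the second, subgradients are bounded and `M' -
M` is at most momentum error plus noise. In the third, `msgn` is a contraction attaining the nuclear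
norm in trace duality, so the score is `⟪d, M'⟫` up to the error of `M'` as an estimate of `-∇F`
(`kktScore_le`). -/

/-! ### Singular values and the matrix sign -/

open Module in
/-- The functional calculus of a Hermitian matrix acts on an eigenvector by the value of the
function at the eigenvalue. -/
theorem cfc_mulVec_of_eigenvector {k : ℕ} {B : Matrix (Fin k) (Fin k) ℝ} (hB : B.IsHermitian)
    (g : ℝ → ℝ) {u : Fin k → ℝ} {μ : ℝ} (hu : B.mulVec u = μ • u) :
    (cfc g B).mulVec u = g μ • u := by
  rcases eq_or_ne u 0 with rfl | hu0
  · simp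
  have hfin : (spectrum ℝ B).Finite := Matrix.finite_real_spectrum
  have hev : End.HasEigenvector (Matrix.toLin' B) μ u :=
    ⟨End.mem_eigenspace_iff.mpr (by simpa using hu), hu0⟩
  have hμ : μ ∈ spectrum ℝ B := by
    rw [← Matrix.spectrum_toLin']
    exact (End.hasEigenvalue_of_hasEigenvector hev).mem_spectrum
  -- The spectrum is finite, so `g` agrees on it with an interpolating polynomial, and polynomials
  -- of a matrix act on eigenvectors by evaluation.
  let p := Lagrange.interpolate hfin.toFinset id g
  have hp : ∀ x ∈ spectrum ℝ B, p.eval x = g x := fun x hx =>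
    Lagrange.eval_interpolate_at_node (v := id) g Function.injective_id.injOn (by simpa using hx)
  have h1 : cfc g B = Polynomial.aeval B p := by
    rw [← cfc_polynomial p B hB.isSelfAdjoint]
    exact cfc_congr fun x hx => (hp x hx).symm
  have h2 := End.aeval_apply_of_hasEigenvector (p := p) hev
  have h3 : Polynomial.aeval (Matrix.toLin' B) p = Matrix.toLin' (Polynomial.aeval B p) :=
    (Polynomial.aeval_algHom_apply (Matrix.toLinAlgEquiv' (R := ℝ)) B p)
  rw [h3, Matrix.toLin'_apply, hp μ hμ] at h2
  rw [h1, h2]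

section SingularValues

variable {n m : ℕ}

/-- The linear map given by a matrix. -/
noncomputable abbrev toLin (X : Mat n m) :
    EuclideanSpace ℝ (Fin m) →ₗ[ℝ] EuclideanSpace ℝ (Fin n) :=
  Matrix.toEuclideanLin (toMatrix X)

theorem toLin_apply (X : Mat n m) (w : EuclideanSpace ℝ (Fin m)) (i : Fin n) :
    toLin X w i = inner ℝ (WithLp.toLp 2 fun k => X (i, k)) w := by
  simp [toLin, toMatrix, Matrix.toLpLin_apply, Matrix.mulVec, dotProduct, PiLp.inner_apply,
    mul_comm]

/-- The Frobenius inner product computed in an orthonormal basis. -/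
theorem inner_eq_sum_toLin {ι : Type*} [Fintype ι]
    (b : OrthonormalBasis ι ℝ (EuclideanSpace ℝ (Fin m))) (X Y : Mat n m) :
    inner ℝ X Y = ∑ j, inner ℝ (toLin X (b j)) (toLin Y (b j)) := by
  have h : ∀ j, inner ℝ (toLin X (b j)) (toLin Y (b j)) =
      ∑ i, inner ℝ (WithLp.toLp 2 fun k => X (i, k)) (b j) *
        inner ℝ (b j) (WithLp.toLp 2 fun k => Y (i, k)) := by
    intro j
    rw [PiLp.inner_apply]
    refine Finset.sum_congr rfl fun i _ => ?_
    rw [toLin_apply, toLin_apply, real_inner_comm _ (b j)]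
    simp [mul_comm]
  simp_rw [h]
  rw [Finset.sum_comm]
  simp_rw [b.sum_inner_mul_inner, PiLp.inner_apply]
  rw [Fintype.sum_prod_type]

/-- Right singular vectors of a matrix. -/
noncomputable def rightBasis (X : Mat n m) :
    OrthonormalBasis (Fin m) ℝ (EuclideanSpace ℝ (Fin m)) :=
  (toLin X).isSymmetric_adjoint_comp_self.eigenvectorBasis (by simp)

theorem adjoint_toLin_rightBasis (X : Mat n m) (j : Fin m) :
    (toLin X).adjoint (toLin X (rightBasis X j)) = singularValue X j ^ 2 • rightBasis X j := by
  have h := (toLin X).isSymmetric_adjoint_comp_self.apply_eigenvectorBasis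
    (n := m) (by simp) j
  rw [singularValue, (toLin X).sq_singularValues_fin (n := m) (by simp)]
  exact h

theorem inner_toLin_rightBasis (X : Mat n m) (i : Fin m) (w : EuclideanSpace ℝ (Fin m)) :
    inner ℝ (toLin X (rightBasis X i)) (toLin X w) =
      singularValue X i ^ 2 * inner ℝ (rightBasis X i) w := by
  rw [← LinearMap.adjoint_inner_left, adjoint_toLin_rightBasis, real_inner_smul_left]

theorem singularValue_nonneg (X : Mat n m) (i : ℕ) : 0 ≤ singularValue X i :=
  LinearMap.singularValues_nonneg _ _

theorem norm_toLin_rightBasis (X : Mat n m) (i : Fin m) :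
    ‖toLin X (rightBasis X i)‖ = singularValue X i := by
  rw [← sq_eq_sq₀ (norm_nonneg _) (singularValue_nonneg _ _), ← real_inner_self_eq_norm_sq,
    inner_toLin_rightBasis, real_inner_self_eq_norm_sq, (rightBasis X).norm_eq_one]
  simp

/-- The rank is at most `min n m`, so later singular values vanish; indexing by `Fin m` matches the
basis of right singular vectors. -/
theorem nuclearNorm_eq_sum (X : Mat n m) : nuclearNorm X = ∑ j : Fin m, singularValue X j := by
  rw [nuclearNorm, Fin.sum_univ_eq_sum_range (fun j => singularValue X j)]
  refine Finset.sum_subset (by simp) fun j _ hj => ?_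
  have hj' : min n m ≤ j := not_lt.mp fun h => hj (Finset.mem_range.mpr h)
  rw [singularValue, LinearMap.singularValues_eq_zero_iff_le_finrank_range]
  refine le_trans (le_min ?_ ?_) hj'
  · simpa using (toLin X).range.finrank_le
  · simpa using (toLin X).finrank_range_le

/-- Right singular vectors have orthogonal images, so Parseval applies on both sides, and the
singular value of index `0` dominates the others. -/
theorem norm_toLin_le (X : Mat n m) (w : EuclideanSpace ℝ (Fin m)) :
    ‖toLin X w‖ ≤ spectralNorm X * ‖w‖ := by
  refine abs_le_of_sq_le_sq' ?_ (mul_nonneg (singularValue_nonneg _ _) (norm_nonneg _)) |>.2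
  have h1 : ‖toLin X w‖ ^ 2 =
      ∑ j : Fin m, singularValue X j ^ 2 * inner ℝ (rightBasis X j) w ^ 2 := by
    rw [← real_inner_self_eq_norm_sq]
    conv_lhs => enter [2]; rw [← (rightBasis X).sum_repr' w]
    rw [map_sum, sum_inner]
    refine Finset.sum_congr rfl fun j _ => ?_
    rw [map_smul, real_inner_smul_left, inner_toLin_rightBasis]
    ring
  rw [h1, mul_pow, ← (rightBasis X).sum_sq_norm_inner_right w, Finset.mul_sum]
  refine Finset.sum_le_sum fun j _ => ?_
  rw [Real.norm_eq_abs, sq_abs]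
  have := (toLin X).singularValues_antitone (Nat.zero_le (j : ℕ))
  exact mul_le_mul_of_nonneg_right
    (pow_le_pow_left₀ (singularValue_nonneg _ _) this 2) (sq_nonneg _)

/-- Trace duality: a contraction has Frobenius inner product at most the nuclear norm. -/
theorem inner_le_nuclearNorm {A : Mat n m} (hA : ∀ w, ‖toLin A w‖ ≤ ‖w‖) (Y : Mat n m) :
    inner ℝ A Y ≤ nuclearNorm Y := by
  rw [inner_eq_sum_toLin (rightBasis Y), nuclearNorm_eq_sum]
  refine Finset.sum_le_sum fun j _ => (real_inner_le_norm _ _).trans ?_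
  rw [norm_toLin_rightBasis]
  refine mul_le_of_le_one_left (singularValue_nonneg _ _) ((hA _).trans ?_)
  rw [(rightBasis Y).norm_eq_one]

theorem singularValue_le_norm (X : Mat n m) (j : Fin m) : singularValue X j ≤ ‖X‖ := by
  refine abs_le_of_sq_le_sq' ?_ (norm_nonneg _) |>.2
  rw [← real_inner_self_eq_norm_sq X, inner_eq_sum_toLin (rightBasis X)]
  simp_rw [real_inner_self_eq_norm_sq, norm_toLin_rightBasis]
  exact Finset.single_le_sum (f := fun j : Fin m => singularValue X j ^ 2)
    (fun _ _ => sq_nonneg _) (Finset.mem_univ j)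

theorem nuclearNorm_le (X : Mat n m) : nuclearNorm X ≤ m * ‖X‖ := by
  rw [nuclearNorm_eq_sum]
  exact (Finset.sum_le_sum fun j _ => singularValue_le_norm X j).trans (by simp)

/-- If `v` is a right singular vector of `A`, then `A v` satisfies the eigenvector equation of `A
Aᵀ` for `σ²`, where the function `x ↦ (√x)⁻¹` takes the value `σ⁻¹`. -/
theorem toLin_msgn_rightBasis (X : Mat n m) (j : Fin m) :
    toLin (msgn X) (rightBasis X j) = (singularValue X j)⁻¹ • toLin X (rightBasis X j) := by
  set A := toMatrix X
  have hB : (A * A.transpose).IsHermitian := by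
    simpa using Matrix.isHermitian_mul_conjTranspose_self A
  have hadj : (toLin X).adjoint = Matrix.toEuclideanLin A.transpose := by
    rw [← Matrix.conjTranspose_eq_transpose_of_trivial, Matrix.toEuclideanLin_conjTranspose_eq_adjoint]
  set v := (rightBasis X j).ofLp
  have h1 : A.transpose.mulVec (A.mulVec v) = singularValue X j ^ 2 • v := by
    have := congrArg WithLp.ofLp (adjoint_toLin_rightBasis X j)
    rw [hadj] at this
    simpa [toLin, Matrix.toLpLin_apply] using this
  have h2 : (A * A.transpose).mulVec (A.mulVec v) = singularValue X j ^ 2 • A.mulVec v := by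
    rw [← Matrix.mulVec_mulVec, h1, Matrix.mulVec_smul]
  have h3 := cfc_mulVec_of_eigenvector hB (fun x : ℝ => (Real.sqrt x)⁻¹) h2
  rw [Real.sqrt_sq (singularValue_nonneg _ _)] at h3
  have h4 : toMatrix (msgn X) = cfc (fun x : ℝ => (Real.sqrt x)⁻¹) (A * A.transpose) * A := rfl
  ext i
  simp only [toLin, h4, Matrix.toLpLin_apply, PiLp.smul_apply]
  rw [← Matrix.mulVec_mulVec, h3]
  rfl

/-- The matrix sign is a contraction. -/
theorem norm_toLin_msgn_le (X : Mat n m) (w : EuclideanSpace ℝ (Fin m)) :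
    ‖toLin (msgn X) w‖ ≤ ‖w‖ := by
  refine abs_le_of_sq_le_sq' ?_ (norm_nonneg _) |>.2
  set b := rightBasis X
  -- The matrix sign is a partial isometry: `σ⁻¹ σ` is `1`, or `0` when `σ = 0`.
  have hu : ∀ i j, inner ℝ (toLin (msgn X) (b i)) (toLin (msgn X) (b j)) =
      if i = j then ((singularValue X i)⁻¹ * singularValue X i) ^ 2 else 0 := by
    intro i j
    rw [toLin_msgn_rightBasis, toLin_msgn_rightBasis, real_inner_smul_left, real_inner_smul_right,
      inner_toLin_rightBasis, orthonormal_iff_ite.mp b.orthonormal i j]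
    split_ifs with h
    · subst h; ring
    · simp
  have h1 : ‖toLin (msgn X) w‖ ^ 2 =
      ∑ j, inner ℝ (b j) w ^ 2 * ((singularValue X j)⁻¹ * singularValue X j) ^ 2 := by
    rw [← real_inner_self_eq_norm_sq]
    conv_lhs => rw [← b.sum_repr' w]
    simp_rw [map_sum, sum_inner, inner_sum, map_smul, real_inner_smul_left, real_inner_smul_right,
      hu]
    simp only [mul_ite, mul_zero, Finset.sum_ite_eq, Finset.mem_univ, if_true]
    exact Finset.sum_congr rfl fun j _ => by ring
  rw [h1, ← b.sum_sq_norm_inner_right w]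
  refine Finset.sum_le_sum fun j _ => ?_
  rw [Real.norm_eq_abs, sq_abs]
  refine mul_le_of_le_one_right (sq_nonneg _) ?_
  rcases eq_or_ne (singularValue X j) 0 with h | h
  · simp [h]
  · simp [inv_mul_cancel₀ h]

theorem inner_msgn_self (X : Mat n m) : inner ℝ (msgn X) X = nuclearNorm X := by
  rw [inner_eq_sum_toLin (rightBasis X), nuclearNorm_eq_sum]
  refine Finset.sum_congr rfl fun j _ => ?_
  rw [toLin_msgn_rightBasis, real_inner_smul_left, real_inner_self_eq_norm_sq,
    norm_toLin_rightBasis]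
  rcases eq_or_ne (singularValue X j) 0 with h | h
  · simp [h]
  · field_simp

/-- The pointwise limit of polynomials that is `x ↦ (√x)⁻¹` for `x ≥ 0`. -/
theorem exists_polynomial_tendsto_inv_sqrt :
    ∃ p : ℕ → Polynomial ℝ, ∀ x : ℝ, 0 ≤ x →
      Filter.Tendsto (fun k => (p k).eval x) Filter.atTop (nhds (Real.sqrt x)⁻¹) := by
  -- This regularization vanishes at `0`, in agreement with the convention `(√0)⁻¹ = 0`. Weierstrass
  -- approximation is applied on `[0, k]`, which eventually contains any given `x ≥ 0`.
  have hc : ∀ k : ℕ, ContinuousOn (fun x : ℝ => Real.sqrt x / (x + 1 / ((k : ℝ) + 1)))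
      (Set.Icc 0 k) := fun k => by
    refine ContinuousOn.div (by fun_prop) (by fun_prop) fun x hx => ?_
    have := hx.1
    positivity
  choose p hp using fun k : ℕ => exists_polynomial_near_of_continuousOn 0 k _ (hc k)
    (1 / ((k : ℝ) + 1)) (by positivity)
  refine ⟨p, fun x hx => ?_⟩
  have h0 : Filter.Tendsto (fun k : ℕ => 1 / ((k : ℝ) + 1)) Filter.atTop (nhds 0) :=
    tendsto_one_div_add_atTop_nhds_zero_nat
  have h1 : Filter.Tendsto (fun k : ℕ => Real.sqrt x / (x + 1 / ((k : ℝ) + 1))) Filter.atTop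
      (nhds (Real.sqrt x)⁻¹) := by
    rcases hx.eq_or_lt with rfl | hx
    · simp
    · have := (tendsto_const_nhds (x := Real.sqrt x)).div (h0.const_add x) (by simpa using hx.ne')
      rwa [add_zero, Real.sqrt_div_self] at this
  have h2 : Filter.Tendsto (fun k : ℕ => (p k).eval x - Real.sqrt x / (x + 1 / ((k : ℝ) + 1)))
      Filter.atTop (nhds 0) := by
    refine squeeze_zero_norm' ?_ h0
    obtain ⟨N, hN⟩ := exists_nat_ge x
    filter_upwards [Filter.eventually_ge_atTop N] with k hk
    exact (hp k x ⟨hx, hN.trans (by exact_mod_cast hk)⟩).le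
  simpa using h2.add h1

/-- The matrix sign jumps where the rank drops, but it is the pointwise limit of the continuous maps
`X ↦ p_k(X Xᵀ) X`. -/
theorem measurable_msgn : Measurable (msgn : Mat n m → Mat n m) := by
  obtain ⟨p, hp⟩ := exists_polynomial_tendsto_inv_sqrt
  refine measurable_of_tendsto_metrizable (f := fun k (X : Mat n m) =>
    (ofMatrix (Polynomial.aeval (toMatrix X * (toMatrix X).transpose) (p k) * toMatrix X) :
      Mat n m)) (fun k => Continuous.measurable ?_) ?_
  · have h1 : Continuous (toMatrix : Mat n m → Matrix (Fin n) (Fin m) ℝ) :=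
      continuous_matrix fun i j => by unfold toMatrix; fun_prop
    have h2 : Continuous (ofMatrix : Matrix (Fin n) (Fin m) ℝ → Mat n m) := by
      unfold ofMatrix; fun_prop
    have h3 : Continuous fun X : Mat n m => toMatrix X * (toMatrix X).transpose :=
      h1.matrix_mul h1.matrix_transpose
    exact h2.comp (((Polynomial.continuous_aeval (p k)).comp h3).matrix_mul h1)
  · rw [tendsto_pi_nhds]
    intro X
    set B := toMatrix X * (toMatrix X).transpose with hBdef
    have hpsd : B.PosSemidef := by
      simpa using Matrix.posSemidef_self_mul_conjTranspose (toMatrix X)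
    have hB := hpsd.isHermitian
    have h2 : Continuous fun C : Matrix (Fin n) (Fin n) ℝ =>
        (ofMatrix (C * toMatrix X) : Mat n m) := by
      unfold ofMatrix; fun_prop
    refine (h2.tendsto _).comp (f := fun k => Polynomial.aeval B (p k)) ?_
    rw [← hBdef]
    -- In a fixed eigenbasis of `B` only the diagonal depends on `k`, and the eigenvalues of `B` are
    -- nonnegative.
    simp_rw [← cfc_polynomial _ B hB.isSelfAdjoint, hB.cfc_eq, Matrix.IsHermitian.cfc,
      Unitary.conjStarAlgAut_apply]
    have h3 : Continuous fun d : Fin n → ℝ =>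
      (hB.eigenvectorUnitary : Matrix (Fin n) (Fin n) ℝ) * Matrix.diagonal d *
        (star hB.eigenvectorUnitary : Matrix (Fin n) (Fin n) ℝ) := by fun_prop
    refine (h3.tendsto _).comp ?_
    rw [tendsto_pi_nhds]
    exact fun i => hp _ (hpsd.eigenvalues_nonneg i)

end SingularValues

/-! ### Deterministic estimates -/

section Deterministic

variable {E : Type*} [NormedAddCommGroup E] [InnerProductSpace ℝ E]

/-- A descent lemma. -/
theorem sub_le_inner_gradient_add [CompleteSpace E] {F : E → ℝ} {L : ℝ} (hF : Differentiable ℝ F)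
    (hL0 : 0 ≤ L) (hL : ∀ X Y, ‖gradient F Y - gradient F X‖ ≤ L * ‖Y - X‖) (X Y : E) :
    F Y - F X ≤ inner ℝ (gradient F X) (Y - X) + L * ‖Y - X‖ ^ 2 := by
  -- The mean value theorem gives the factor `L` instead of the sharp `L / 2`, which affects only
  -- the final constant.
  obtain ⟨Z, hZ, h⟩ := domain_mvt (f := F) (f' := fderiv ℝ F)
    (fun x _ => (hF x).hasFDerivAt.hasFDerivWithinAt) convex_univ (Set.mem_univ X) (Set.mem_univ Y)
  have h1 : fderiv ℝ F Z (Y - X) = inner ℝ (gradient F Z) (Y - X) := by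
    rw [gradient, InnerProductSpace.toDual_symm_apply]
  have h2 : inner ℝ (gradient F Z) (Y - X) =
      inner ℝ (gradient F X) (Y - X) + inner ℝ (gradient F Z - gradient F X) (Y - X) := by
    rw [inner_sub_left]; ring
  have h3 : ‖Z - X‖ ≤ ‖Y - X‖ := norm_sub_le_of_mem_segment hZ
  rw [h, h1, h2]
  refine add_le_add_right ((real_inner_le_norm _ _).trans ?_) _
  calc _ ≤ (L * ‖Z - X‖) * ‖Y - X‖ := by gcongr; exact hL X Z
    _ ≤ (L * ‖Y - X‖) * ‖Y - X‖ := by gcongr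
    _ = _ := by ring

/-- A sequence driven by the implicit weight-decay step with bounded updates stays bounded. -/
theorem norm_smul_le_of_implicit_step {lam η R : ℝ} (hlam : 0 < lam) (hη : 0 < η)
    {x v : ℕ → E} (hx : ∀ t, x (t + 1) = x t + η • (v (t + 1) - lam • x (t + 1)))
    (hv : ∀ t, ‖v (t + 1)‖ ≤ R) (t : ℕ) : ‖lam • x t‖ ≤ ‖lam • x 0‖ + R := by
  have hR : 0 ≤ R := (norm_nonneg _).trans (hv 0)
  induction t with
  | zero => linarith
  | succ t ih =>
    have h1 : lam • x t + (η * lam) • v (t + 1) = (1 + η * lam) • lam • x (t + 1) := by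
      have := hx t
      have h2 : x t = x (t + 1) - η • (v (t + 1) - lam • x (t + 1)) := by
        rw [eq_sub_iff_add_eq, ← this]
      rw [h2]; module
    have hp : 0 < η * lam := mul_pos hη hlam
    have h3 : (1 + η * lam) * ‖lam • x (t + 1)‖ ≤
        (1 + η * lam) * (‖lam • x 0‖ + R) := by
      calc (1 + η * lam) * ‖lam • x (t + 1)‖ = ‖(1 + η * lam) • lam • x (t + 1)‖ := by
            rw [norm_smul (1 + η * lam), Real.norm_of_nonneg (by positivity)]
        _ ≤ ‖lam • x t‖ + ‖(η * lam) • v (t + 1)‖ := by rw [← h1]; exact norm_add_le _ _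
        _ = ‖lam • x t‖ + (η * lam) * ‖v (t + 1)‖ := by
            rw [norm_smul (η * lam), Real.norm_of_nonneg hp.le]
        _ ≤ (‖lam • x 0‖ + R) + (η * lam) * (‖lam • x 0‖ + R) := by
            gcongr
            have := hv t
            have := norm_nonneg (lam • x 0)
            linarith
        _ = _ := by ring
    exact le_of_mul_le_mul_left h3 (by positivity)

/-- A convex set is invariant under the implicit weight-decay step. -/
theorem smul_mem_of_implicit_step {lam η : ℝ} (hlam : 0 < lam) (hη : 0 < η) {B : Set E}
    (hB : Convex ℝ B) {x v : ℕ → E}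
    (hx : ∀ t, x (t + 1) = x t + η • (v (t + 1) - lam • x (t + 1)))
    (hv : ∀ t, v (t + 1) ∈ B) (h0 : lam • x 0 ∈ B) (t : ℕ) : lam • x t ∈ B := by
  induction t with
  | zero => exact h0
  | succ t ih =>
    have hp : 0 < η * lam := mul_pos hη hlam
    have h1 : lam • x (t + 1) = (1 / (1 + η * lam)) • (lam • x t) +
        (η * lam / (1 + η * lam)) • v (t + 1) := by
      have h2 : x t = x (t + 1) - η • (v (t + 1) - lam • x (t + 1)) := by
        rw [eq_sub_iff_add_eq, ← hx t]
      rw [h2]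
      have : (1 + η * lam) ≠ 0 := by positivity
      match_scalars <;> field_simp <;> ring
    rw [h1]
    exact hB ih (hv t) (by positivity) (by positivity) (by field_simp)

/-- The cumulative error of momentum as an estimator of the gradient. -/
theorem sum_momentum_error_le {β L c η : ℝ} (hβ0 : 0 ≤ β) (hβ1 : β < 1) {q m g : ℕ → E}
    (hm : ∀ t, m (t + 1) = β • m t - (1 - β) • g t)
    (hq : ∀ t, ‖q (t + 1) - q t‖ ≤ L * (c * η)) (T : ℕ) :
    ∑ t ∈ Finset.range T, (‖m t + q t‖ + ‖g t - q t‖) ≤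
      (‖m 0 + q 0‖ + T * (L * (c * η))) / (1 - β) + 2 * ∑ t ∈ Finset.range T, ‖g t - q t‖ := by
  have hb : 0 < 1 - β := by linarith
  have hstep : ∀ t, ‖m (t + 1) + q (t + 1)‖ ≤
      β * ‖m t + q t‖ + (1 - β) * ‖g t - q t‖ + L * (c * η) := by
    intro t
    have h : m (t + 1) + q (t + 1) =
        β • (m t + q t) - (1 - β) • (g t - q t) + (q (t + 1) - q t) := by
      rw [hm]; module
    rw [h]
    refine (norm_add_le _ _).trans (add_le_add ((norm_sub_le _ _).trans ?_) (hq t))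
    rw [norm_smul, norm_smul, Real.norm_of_nonneg hβ0, Real.norm_of_nonneg hb.le]
  -- Keeping the last error on the left lets the contraction telescope: `β` times the error plus the
  -- new summand `1 - β` times it restores the error.
  have hsum : ∀ T : ℕ, ‖m T + q T‖ + (1 - β) * ∑ t ∈ Finset.range T, ‖m t + q t‖ ≤
      ‖m 0 + q 0‖ + T * (L * (c * η)) + (1 - β) * ∑ t ∈ Finset.range T, ‖g t - q t‖ := by
    intro T
    induction T with
    | zero => simp
    | succ T ih =>
      rw [Finset.sum_range_succ, Finset.sum_range_succ]
      push_cast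
      have := hstep T
      linarith
  have h := hsum T
  rw [Finset.sum_add_distrib]
  have h2 : ∑ t ∈ Finset.range T, ‖m t + q t‖ ≤
      (‖m 0 + q 0‖ + T * (L * (c * η))) / (1 - β) + ∑ t ∈ Finset.range T, ‖g t - q t‖ := by
    rw [← mul_le_mul_iff_right₀ hb, mul_add, mul_div_cancel₀ _ hb.ne']
    have := norm_nonneg (m T + q T)
    linarith
  linarith

/-- The Nesterov-type combination of momentum and gradient is controlled by both errors. -/
theorem norm_interpolated_momentum_add_le {β : ℝ} (hβ0 : 0 ≤ β) (hβ1 : β ≤ 1) (q m g : E) :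
    ‖(β • m - (1 - β) • g) + q‖ ≤ ‖m + q‖ + ‖g - q‖ := by
  have h : (β • m - (1 - β) • g) + q = β • (m + q) - (1 - β) • (g - q) := by module
  rw [h]
  refine (norm_sub_le _ _).trans ?_
  rw [norm_smul, norm_smul, Real.norm_of_nonneg hβ0, Real.norm_of_nonneg (by linarith)]
  have := norm_nonneg (m + q)
  have := norm_nonneg (g - q)
  nlinarith

/-- Telescoping the descent of `F` along the implicit step. -/
theorem sum_inner_step_le [CompleteSpace E] {F : E → ℝ} {L Fmin : ℝ} (hF : Differentiable ℝ F) (hL0 : 0 ≤ L)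
    (hL : ∀ X Y, ‖gradient F Y - gradient F X‖ ≤ L * ‖Y - X‖) (hmin : ∀ X, Fmin ≤ F X)
    {η c : ℝ} (hη : 0 < η) {x d m' : ℕ → E} {W : ℕ → ℝ}
    (hx : ∀ t, x (t + 1) = x t + η • d (t + 1)) (hd : ∀ t, ‖d (t + 1)‖ ≤ c)
    (hW : ∀ t, ‖m' (t + 1) + gradient F (x t)‖ ≤ W t) (T : ℕ) :
    ∑ t ∈ Finset.range T, inner ℝ (d (t + 1)) (m' (t + 1)) ≤
      (F (x 0) - Fmin) / η + T * (L * c ^ 2 * η) + c * ∑ t ∈ Finset.range T, W t := by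
  have hc : 0 ≤ c := (norm_nonneg _).trans (hd 0)
  have hstep : ∀ t, η * inner ℝ (d (t + 1)) (m' (t + 1)) ≤
      F (x t) - F (x (t + 1)) + η * (L * c ^ 2 * η + c * W t) := by
    intro t
    have h1 := sub_le_inner_gradient_add hF hL0 hL (x t) (x (t + 1))
    rw [hx t, add_sub_cancel_left, inner_smul_right, norm_smul, Real.norm_of_nonneg hη.le,
      ← hx t] at h1
    -- The gradient is replaced by `-m'`, at a cost controlled by `W`.
    have h2 : inner ℝ (gradient F (x t)) (d (t + 1)) =
        inner ℝ (m' (t + 1) + gradient F (x t)) (d (t + 1)) -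
          inner ℝ (d (t + 1)) (m' (t + 1)) := by
      rw [inner_add_left, real_inner_comm (m' (t + 1))]; ring
    have h3 : inner ℝ (m' (t + 1) + gradient F (x t)) (d (t + 1)) ≤ W t * c :=
      (real_inner_le_norm _ _).trans
        (mul_le_mul (hW t) (hd t) (norm_nonneg _) ((norm_nonneg _).trans (hW t)))
    have h4 : L * (η * ‖d (t + 1)‖) ^ 2 ≤ L * (η * c) ^ 2 := by
      gcongr; exact hd t
    rw [h2] at h1
    have h5 := mul_le_mul_of_nonneg_left h3 hη.le
    nlinarith
  have hsum : η * ∑ t ∈ Finset.range T, inner ℝ (d (t + 1)) (m' (t + 1)) ≤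
      F (x 0) - F (x T) + η * (T * (L * c ^ 2 * η) + c * ∑ t ∈ Finset.range T, W t) := by
    rw [Finset.mul_sum]
    refine (Finset.sum_le_sum fun t _ => hstep t).trans (le_of_eq ?_)
    rw [Finset.sum_add_distrib, Finset.sum_range_sub' (fun t => F (x t))]
    simp only [Finset.sum_add_distrib, ← Finset.mul_sum, Finset.sum_const, Finset.card_range,
      nsmul_eq_mul]
    ring
  rw [add_assoc, ← mul_le_mul_iff_right₀ hη, mul_add, mul_div_cancel₀ _ hη.ne']
  linarith [hmin (x T)]

end Deterministic

/-! ### Norms, dual balls and subgradients -/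

section Dual

variable {n m : ℕ}

/-- The unit ball of the dual of a function that plays the role of a norm. -/
def dualBall (K : Mat n m → ℝ) : Set (Mat n m) := {X | ∀ Y, inner ℝ X Y ≤ K Y}

theorem convex_dualBall (K : Mat n m → ℝ) : Convex ℝ (dualBall K) := by
  intro X hX Y hY a b ha hb hab Z
  rw [inner_add_left, real_inner_smul_left, real_inner_smul_left]
  have h1 := mul_le_mul_of_nonneg_left (hX Z) ha
  have h2 := mul_le_mul_of_nonneg_left (hY Z) hb
  have : a * K Z + b * K Z = K Z := by rw [← add_mul, hab, one_mul]
  linarith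

theorem norm_le_of_mem_dualBall {K : Mat n m → ℝ} {R : ℝ} (hR : 0 ≤ R) (hK : ∀ Y, K Y ≤ R * ‖Y‖)
    {X : Mat n m} (hX : X ∈ dualBall K) : ‖X‖ ≤ R := by
  have h := (hX X).trans (hK X)
  rw [real_inner_self_eq_norm_sq] at h
  by_contra! hlt
  nlinarith [norm_nonneg X]

/-- Expansion in the standard basis; the resulting `R` bounds the dual ball and with it all
subgradients of `K`. -/
theorem exists_seminorm_le (K : Seminorm ℝ (Mat n m)) : ∃ R, 0 ≤ R ∧ ∀ Y, K Y ≤ R * ‖Y‖ := by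
  refine ⟨∑ p, K (EuclideanSpace.single p 1), by positivity, fun Y => ?_⟩
  have h : Y = ∑ p, Y p • EuclideanSpace.single p (1 : ℝ) := by
    have := (EuclideanSpace.basisFun (Fin n × Fin m) ℝ).sum_repr Y
    simpa using this.symm
  calc K Y = K (∑ p, Y p • EuclideanSpace.single p (1 : ℝ)) := by rw [← h]
    _ ≤ ∑ p, K (Y p • EuclideanSpace.single p (1 : ℝ)) := by
        exact Finset.le_sum_of_subadditive K (map_zero K).le (map_add_le_add K) _ _
    _ ≤ ∑ p, K (EuclideanSpace.single p 1) * ‖Y‖ := by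
        refine Finset.sum_le_sum fun p _ => ?_
        rw [map_smul_eq_mul, mul_comm]
        exact mul_le_mul_of_nonneg_left (PiLp.norm_apply_le Y p) (apply_nonneg K _)
    _ = _ := by rw [Finset.sum_mul]

theorem IsSubgradient.le {K : Mat n m → ℝ} {X G : Mat n m}
    (h : IsSubgradient (fun Y => (K Y : EReal)) X G) (Y : Mat n m) :
    K X + inner ℝ G (Y - X) ≤ K Y := by
  have := h Y
  simp only at this
  exact_mod_cast this

/-- Euler's identity for a homogeneous function, from the subgradient inequality at `0` and at `2X`.
-/
theorem inner_subgradient_self (K : Seminorm ℝ (Mat n m)) {X G : Mat n m}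
    (h : IsSubgradient (fun Y => (K Y : EReal)) X G) : inner ℝ G X = K X := by
  have h0 := h.le 0
  have h2 := h.le ((2 : ℝ) • X)
  rw [map_zero, zero_sub, inner_neg_right] at h0
  rw [map_smul_eq_mul, two_smul, add_sub_cancel_right, Real.norm_of_nonneg zero_le_two] at h2
  linarith

theorem subgradient_mem_dualBall (K : Seminorm ℝ (Mat n m)) {X G : Mat n m}
    (h : IsSubgradient (fun Y => (K Y : EReal)) X G) : G ∈ dualBall K := by
  intro Y
  have h1 := h.le (X + Y)
  rw [add_sub_cancel_left] at h1
  linarith [map_add_le_add K X Y]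

theorem subgradient_monotone {K : Mat n m → ℝ} {X Y G H : Mat n m}
    (hG : IsSubgradient (fun Y => (K Y : EReal)) X G)
    (hH : IsSubgradient (fun Y => (K Y : EReal)) Y H) : 0 ≤ inner ℝ (G - H) (X - Y) := by
  have h1 := hG.le Y
  have h2 := hH.le X
  rw [inner_sub_left]
  rw [← neg_sub X Y, inner_neg_right] at h1
  linarith

/-- The conjugate of a norm is the indicator of the dual ball; here the supremum is attained at `Y =
0`. -/
theorem conjugate_eq_zero (K : Seminorm ℝ (Mat n m)) {X : Mat n m} (hX : X ∈ dualBall K) :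
    conjugate K X = 0 := by
  refine le_antisymm (iSup_le fun Y => ?_) (le_iSup_of_le 0 (by simp))
  exact_mod_cast sub_nonpos.mpr (hX Y)

/-- By homogeneity, the multiples `k • Y` of a violating `Y` make the supremum infinite. -/
theorem mem_dualBall_of_conjugate_lt_top (K : Seminorm ℝ (Mat n m)) {X : Mat n m}
    (hX : conjugate K X < ⊤) : X ∈ dualBall K := by
  intro Y
  by_contra! hlt
  refine hX.ne (EReal.eq_top_iff_forall_lt _ |>.mpr fun y => ?_)
  obtain ⟨k, hk⟩ := exists_nat_gt (y / (inner ℝ X Y - K Y))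
  have hpos : 0 < inner ℝ X Y - K Y := sub_pos.mpr hlt
  rw [div_lt_iff₀ hpos] at hk
  refine lt_of_lt_of_le ?_ (le_iSup _ ((k : ℝ) • Y))
  rw [EReal.coe_lt_coe_iff, inner_smul_right, map_smul_eq_mul, Real.norm_of_nonneg k.cast_nonneg]
  linarith

/-- A subgradient of the conjugate of a norm is an outer normal of the dual ball. -/
theorem inner_subgradient_conjugate_le (K : Seminorm ℝ (Mat n m)) {X Z Y : Mat n m}
    (hX : X ∈ dualBall K) (hZ : IsSubgradient (conjugate K) X Z) (hY : Y ∈ dualBall K) :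
    inner ℝ Z (Y - X) ≤ 0 := by
  have h := hZ Y
  rw [conjugate_eq_zero K hX, conjugate_eq_zero K hY, zero_add] at h
  exact_mod_cast h

/-- A chosen subgradient of the conjugate is orthogonal to the displacement of an implicit step. -/
theorem inner_implicit_step_sub_subgradient (K : Seminorm ℝ (Mat n m)) {lam η : ℝ}
    (hlam : 0 < lam) (hη : 0 < η) {x y v Z W : Mat n m} (hy : y = x + η • (v - lam • y))
    (hxB : lam • x ∈ dualBall K) (hyB : lam • y ∈ dualBall K) (hvB : v ∈ dualBall K)
    (hZ : IsSubgradient (conjugate K) (lam • y) Z) :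
    inner ℝ (v - lam • y) (W - Z) = inner ℝ (v - lam • y) W := by
  -- From `λy`, the ball points `v` and `λx` lie in opposite directions, so the normal `Z` has both
  -- signs on `v - λy`, hence is orthogonal to it.
  have h1 := inner_subgradient_conjugate_le K hyB hZ hvB
  have h2 := inner_subgradient_conjugate_le K hyB hZ hxB
  have h3 : lam • x - lam • y = -((lam * η) • (v - lam • y)) := by
    have hx : x = y - η • (v - lam • y) := by rw [eq_sub_iff_add_eq, ← hy]
    nth_rewrite 1 [hx]
    module
  rw [h3, inner_neg_right, inner_smul_right] at h2
  have h4 : 0 ≤ inner ℝ Z (v - lam • y) := by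
    have := mul_pos hlam hη
    by_contra! h
    nlinarith
  rw [inner_sub_right, real_inner_comm Z, le_antisymm h1 h4, sub_zero]

end Dual

/-! ### The stochastic gradient along a run -/

section Stochastic

variable {n m : ℕ} {Ω Ξ : Type*} [MeasurableSpace Ω] [MeasurableSpace Ξ]

/-- The stochastic gradient is jointly measurable in the point and the sample. -/
theorem measurable_stochGrad {ℓ : Mat n m → Ξ → ℝ} (hmeas : ∀ X, Measurable (ℓ X))
    (hdiff : ∀ x, Differentiable ℝ fun X => ℓ X x) :
    Measurable fun p : Mat n m × Ξ => stochGrad ℓ p.1 p.2 := by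
  have hjoint : Measurable fun p : Mat n m × Ξ => ℓ p.1 p.2 :=
    measurable_uncurry_of_continuous_of_measurable (u := ℓ) (fun x => (hdiff x).continuous) hmeas
  have hcoord : ∀ q : Fin n × Fin m, Measurable fun p : Mat n m × Ξ => stochGrad ℓ p.1 p.2 q := by
    intro q
    let e : Mat n m := EuclideanSpace.single q 1
    -- Each partial derivative is a limit of difference quotients with step `1/k`, which are
    -- measurable because the loss is continuous in the point and measurable in the sample.
    refine measurable_of_tendsto_metrizable
      (f := fun (k : ℕ) (p : Mat n m × Ξ) =>
        (k : ℝ) * (ℓ (p.1 + (k : ℝ)⁻¹ • e) p.2 - ℓ p.1 p.2)) (fun k => ?_) ?_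
    · have : Measurable fun p : Mat n m × Ξ => (p.1 + (k : ℝ)⁻¹ • e, p.2) := by fun_prop
      exact ((hjoint.comp this).sub hjoint).const_mul _
    · rw [tendsto_pi_nhds]
      rintro ⟨X, x⟩
      have h1 : stochGrad ℓ X x q = fderiv ℝ (fun Y => ℓ Y x) X e := by
        have : fderiv ℝ (fun Y => ℓ Y x) X e = inner ℝ (stochGrad ℓ X x) e := by
          rw [stochGrad, gradient, InnerProductSpace.toDual_symm_apply]
        rw [this]
        simp [e, EuclideanSpace.inner_single_right]
      rw [h1]
      exact ((hdiff x X).hasFDerivAt.lim_real e).comp tendsto_natCast_atTop_atTop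
  have : (fun p : Mat n m × Ξ => stochGrad ℓ p.1 p.2) =
      fun p => WithLp.toLp 2 fun q => stochGrad ℓ p.1 p.2 q := rfl
  rw [this]
  exact (PiLp.continuous_toLp 2 _).measurable.comp (measurable_pi_lambda _ hcoord)

/-- First absolute moment of the noise of the stochastic gradient. -/
theorem lintegral_noise_le {F : Mat n m → ℝ} {D : Measure Ξ} [IsProbabilityMeasure D]
    {ℓ : Mat n m → Ξ → ℝ} {v : ℝ} (h : IsStochasticModel F D ℓ v) (X : Mat n m) :
    ∫⁻ x, ‖stochGrad ℓ X x - gradient F X‖ₑ ∂D ≤ ENNReal.ofReal (√v) := by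
  have hLp : MemLp (fun x => stochGrad ℓ X x - gradient F X) 2 D :=
    (h.memLp_grad X).sub (memLp_const _)
  rw [← eLpNorm_one_eq_lintegral_enorm]
  refine (eLpNorm_le_eLpNorm_of_exponent_le one_le_two hLp.aestronglyMeasurable).trans ?_
  rw [hLp.eLpNorm_eq_integral_rpow_norm two_ne_zero ENNReal.ofNat_ne_top]
  refine ENNReal.ofReal_le_ofReal ?_
  have hv := h.variance_le X
  -- Unbiasedness makes `∇F(X)` the centre of the variance.
  rw [variance, h.unbiased X] at hv
  simp only [ENNReal.toReal_ofNat, Real.rpow_ofNat]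
  rw [← one_div, ← Real.sqrt_eq_rpow]
  exact Real.sqrt_le_sqrt hv

/-- The information contained in the samples before time `t`. -/
abbrev past (ξ : ℕ → Ω → Ξ) (t : ℕ) : MeasurableSpace Ω :=
  ⨆ i ∈ Set.Iio t, MeasurableSpace.comap (ξ i) inferInstance

theorem past_le {ξ : ℕ → Ω → Ξ} (hξ : ∀ t, Measurable (ξ t)) (t : ℕ) :
    past ξ t ≤ (inferInstance : MeasurableSpace Ω) :=
  iSup₂_le fun i _ => (hξ i).comap_le

omit [MeasurableSpace Ω] in
theorem past_mono (ξ : ℕ → Ω → Ξ) {s t : ℕ} (h : s ≤ t) : past ξ s ≤ past ξ t :=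
  biSup_mono fun _ hi => lt_of_lt_of_le hi h

variable {gradK : Mat n m → Mat n m} {β₁ β₂ lam η : ℝ} {X₀ M₀ : Mat n m} {ℓ : Mat n m → Ξ → ℝ}
  {ξ : ℕ → Ω → Ξ} {X M M' : ℕ → Ω → Mat n m}

omit [MeasurableSpace Ω] in
/-- The iterates at time `t` depend measurably on the samples before time `t`. -/
theorem IsRun.measurable_past (h : IsRun gradK β₁ β₂ lam η X₀ M₀ ℓ ξ X M M')
    (hgradK : Measurable gradK)
    (hG : Measurable fun p : Mat n m × Ξ => stochGrad ℓ p.1 p.2) (hpos : 0 < η * lam) (t : ℕ) :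
    Measurable[past ξ t] (X t) ∧ Measurable[past ξ t] (M t) := by
  induction t with
  | zero =>
    rw [funext h.init_X, funext h.init_M]
    exact ⟨measurable_const, measurable_const⟩
  | succ t ih =>
    have hX : Measurable[past ξ (t + 1)] (X t) := ih.1.mono (past_mono ξ t.le_succ) le_rfl
    have hM : Measurable[past ξ (t + 1)] (M t) := ih.2.mono (past_mono ξ t.le_succ) le_rfl
    have hξ : Measurable[past ξ (t + 1)] (ξ t) :=
      (comap_measurable (ξ t)).mono
        (le_iSup₂_of_le t (Set.mem_Iio.mpr t.lt_succ_self) le_rfl) le_rfl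
    have hGt : Measurable[past ξ (t + 1)] fun ω => stochGrad ℓ (X t ω) (ξ t ω) :=
      hG.comp (hX.prodMk hξ)
    have hM' : Measurable[past ξ (t + 1)] (M' (t + 1)) := by
      rw [funext (h.step_M' t)]
      exact (hM.const_smul β₁).sub (hGt.const_smul (1 - β₁))
    -- The implicit equation is linear in the new iterate, so it has an explicit, measurable
    -- solution.
    have hXeq : X (t + 1) = fun ω => (1 + η * lam)⁻¹ • (X t ω + η • gradK (M' (t + 1) ω)) := by
      funext ω
      rw [eq_inv_smul_iff₀ (by positivity)]
      have := h.step_X t ω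
      have h2 : X t ω = X (t + 1) ω - η • (gradK (M' (t + 1) ω) - lam • X (t + 1) ω) := by
        rw [eq_sub_iff_add_eq, ← this]
      rw [h2]; module
    constructor
    · rw [hXeq]
      have hg : Measurable[past ξ (t + 1)] fun ω => gradK (M' (t + 1) ω) := hgradK.comp hM'
      exact (hX.add (hg.const_smul η)).const_smul (1 + η * lam)⁻¹
    · rw [funext (h.step_M t)]
      exact (hM.const_smul β₂).sub (hGt.const_smul (1 - β₂))

/-- An iterate is independent of the sample that is drawn at it. -/
theorem IsIIDSample.indepFun_of_measurable_past {P : Measure Ω} {D : Measure Ξ}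
    (hξ : IsIIDSample P D ξ) {t : ℕ} {Y : Ω → Mat n m} (hY : Measurable[past ξ t] Y) :
    IndepFun Y (ξ t) P := by
  rw [IndepFun_iff_Indep]
  have h := indep_iSup_of_disjoint (fun i => (hξ.measurable i).comap_le) hξ.indep
    (S := Set.Iio t) (T := {t}) (by simp)
  refine indep_of_indep_of_le_left (indep_of_indep_of_le_right h ?_) hY.comap_le
  exact le_iSup₂_of_le t rfl le_rfl

/-- The first absolute moment of the noise at a point that depends on the past. -/
theorem lintegral_noise_comp_le {F : Mat n m → ℝ} {P : Measure Ω} [IsProbabilityMeasure P]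
    {D : Measure Ξ} [IsProbabilityMeasure D] {v : ℝ} (h : IsStochasticModel F D ℓ v)
    (hF : Continuous (gradient F)) (hξ : IsIIDSample P D ξ) {t : ℕ} {Y : Ω → Mat n m}
    (hY : Measurable[past ξ t] Y) :
    ∫⁻ ω, ‖stochGrad ℓ (Y ω) (ξ t ω) - gradient F (Y ω)‖ₑ ∂P ≤ ENNReal.ofReal (√v) := by
  have hY' : Measurable Y := hY.mono (past_le hξ.measurable t) le_rfl
  have hG := measurable_stochGrad h.measurable_loss h.differentiable_loss
  have hm : Measurable fun p : Mat n m × Ξ => ‖stochGrad ℓ p.1 p.2 - gradient F p.1‖ₑ :=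
    (hG.sub (hF.measurable.comp measurable_fst)).enorm
  -- Independence makes the joint law a product, so the noise bound at each fixed point can be
  -- integrated over the law of `Y`.
  have hmap : P.map (fun ω => (Y ω, ξ t ω)) = (P.map Y).prod D := by
    rw [← hξ.law t]
    exact (hξ.indepFun_of_measurable_past hY).map_prod_eq_prod_map_map hY'.aemeasurable
      (hξ.measurable t).aemeasurable
  have hprob : IsProbabilityMeasure (P.map Y) := Measure.isProbabilityMeasure_map hY'.aemeasurable
  calc ∫⁻ ω, ‖stochGrad ℓ (Y ω) (ξ t ω) - gradient F (Y ω)‖ₑ ∂P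
      = ∫⁻ p, ‖stochGrad ℓ p.1 p.2 - gradient F p.1‖ₑ ∂(P.map fun ω => (Y ω, ξ t ω)) :=
        (lintegral_map hm (hY'.prodMk (hξ.measurable t))).symm
    _ = ∫⁻ Z, ∫⁻ x, ‖stochGrad ℓ Z x - gradient F Z‖ₑ ∂D ∂(P.map Y) := by
        rw [hmap, lintegral_prod _ hm.aemeasurable]
    _ ≤ ∫⁻ _, ENNReal.ofReal (√v) ∂(P.map Y) := lintegral_mono fun Z => lintegral_noise_le h Z
    _ = ENNReal.ofReal (√v) := by simp

end Stochastic

/-! ### From pathwise estimates to the minimal expectation -/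

section MinExpectation

variable {Ω : Type*} [MeasurableSpace Ω] {P : Measure Ω}

theorem MinExpectationBound.mono {Q : ℕ → Ω → ℝ} {T : ℕ} {hT : 1 ≤ T} {B B' : ℝ}
    (h : MinExpectationBound P Q T hT B) (hB : B ≤ B') : MinExpectationBound P Q T hT B' :=
  ⟨h.1, h.2.trans hB⟩

/-- The minimum is at most the average. For `η` of order `1/√T`, both `a₁ / η` and `T a₃ η` are
`O(√T)`, and the noise adds at most `a₄ T s`; nonnegativity of `Q` disposes of the absolute value.
-/
theorem minExpectationBound_of_sum_le {Q N : ℕ → Ω → ℝ} [IsProbabilityMeasure P] {T : ℕ}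
    (hT : 1 ≤ T)
    {η θ₁ θ₂ s a₁ a₂ a₃ a₄ : ℝ} (hθ₁ : 0 < θ₁) (hη₁ : θ₁ / √(T : ℝ) ≤ η) (hη₂ : η ≤ θ₂ / √(T : ℝ))
    (ha₁ : 0 ≤ a₁) (ha₂ : 0 ≤ a₂) (ha₃ : 0 ≤ a₃) (ha₄ : 0 ≤ a₄) (hs : 0 ≤ s)
    (hQ : ∀ t, Integrable (Q (t + 1)) P) (hQ0 : ∀ t ω, 0 ≤ Q (t + 1) ω)
    (hN : ∀ t, Integrable (N t) P) (hNs : ∀ t, ∫ ω, N t ω ∂P ≤ s)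
    (hsum : ∀ ω, ∑ t ∈ Finset.range T, Q (t + 1) ω ≤
      a₁ / η + a₂ + T * (a₃ * η) + a₄ * ∑ t ∈ Finset.range T, N t ω) :
    MinExpectationBound P Q T hT ((a₁ / θ₁ + a₂ + a₃ * θ₂ + a₄) * (1 / √(T : ℝ) + s)) := by
  refine ⟨fun t ht => ?_, ?_⟩
  · obtain ⟨k, rfl⟩ := Nat.exists_eq_add_of_le' (Finset.mem_Icc.mp ht).1
    exact hQ k
  have hT0 : (0 : ℝ) < T := by exact_mod_cast hT
  have hT1 : (1 : ℝ) ≤ T := by exact_mod_cast hT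
  have hr : 0 < √(T : ℝ) := Real.sqrt_pos.mpr hT0
  have hrr : √(T : ℝ) * √(T : ℝ) = T := Real.mul_self_sqrt hT0.le
  have hr1 : 1 ≤ √(T : ℝ) := Real.one_le_sqrt.mpr hT1
  have hη : 0 < η := (div_pos hθ₁ hr).trans_le hη₁
  set μ := (Finset.Icc 1 T).inf' (Finset.nonempty_Icc.mpr hT) fun t => ∫ ω, Q t ω ∂P with hμ
  have hμ0 : 0 ≤ μ := by
    refine Finset.le_inf' _ _ fun t ht => ?_
    obtain ⟨k, rfl⟩ := Nat.exists_eq_add_of_le' (Finset.mem_Icc.mp ht).1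
    exact integral_nonneg (hQ0 k)
  have h1 : T * μ ≤ ∑ t ∈ Finset.range T, ∫ ω, Q (t + 1) ω ∂P := by
    have : ∀ t ∈ Finset.range T, μ ≤ ∫ ω, Q (t + 1) ω ∂P := fun t ht =>
      Finset.inf'_le (fun t => ∫ ω, Q t ω ∂P)
        (Finset.mem_Icc.mpr ⟨Nat.le_add_left 1 t, Finset.mem_range.mp ht⟩)
    simpa using Finset.card_nsmul_le_sum _ _ _ this
  have h2 : ∑ t ∈ Finset.range T, ∫ ω, Q (t + 1) ω ∂P ≤
      a₁ / η + a₂ + T * (a₃ * η) + a₄ * (T * s) := by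
    rw [← integral_finsetSum _ fun t _ => hQ t]
    have hNint : Integrable (fun ω => ∑ t ∈ Finset.range T, N t ω) P :=
      integrable_finsetSum _ fun t _ => hN t
    refine (integral_mono (integrable_finsetSum _ fun t _ => hQ t)
      ((integrable_const _).add (hNint.const_mul a₄)) hsum).trans ?_
    simp only [Pi.add_apply]
    rw [integral_add (integrable_const _) (hNint.const_mul a₄), integral_const_mul,
      integral_finsetSum _ fun t _ => hN t]
    simp only [integral_const, probReal_univ, one_smul]
    gcongr
    simpa using Finset.sum_le_sum fun t (_ : t ∈ Finset.range T) => hNs t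
  have h3 : a₁ / η ≤ a₁ / θ₁ * √(T : ℝ) := by
    rw [div_mul_eq_mul_div, div_le_div_iff₀ hη hθ₁, mul_assoc]
    rw [div_le_iff₀ hr, mul_comm] at hη₁
    gcongr
  have h4 : a₂ ≤ a₂ * √(T : ℝ) := le_mul_of_one_le_right ha₂ hr1
  have h5 : T * (a₃ * η) ≤ a₃ * θ₂ * √(T : ℝ) := by
    rw [le_div_iff₀ hr] at hη₂
    calc T * (a₃ * η) = √(T : ℝ) * √(T : ℝ) * (a₃ * η) := by rw [hrr]
      _ = a₃ * (η * √(T : ℝ)) * √(T : ℝ) := by ring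
      _ ≤ a₃ * θ₂ * √(T : ℝ) := by gcongr
  have hθ₂ : 0 ≤ θ₂ := by
    have := (div_pos hθ₁ hr).trans_le (hη₁.trans hη₂)
    exact (div_pos_iff_of_pos_right hr).mp this |>.le
  have hcoef : 0 ≤ a₁ / θ₁ + a₂ + a₃ * θ₂ := by positivity
  rw [abs_of_nonneg hμ0, ← mul_le_mul_iff_right₀ hT0]
  refine (h1.trans h2).trans ?_
  have h6 : T * ((a₁ / θ₁ + a₂ + a₃ * θ₂ + a₄) * (1 / √(T : ℝ) + s)) =
      (a₁ / θ₁ + a₂ + a₃ * θ₂ + a₄) * √(T : ℝ) + (a₁ / θ₁ + a₂ + a₃ * θ₂ + a₄) * (T * s) := by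
    have : T * (1 / √(T : ℝ)) = √(T : ℝ) := by rw [mul_one_div, Real.div_sqrt]
    linear_combination (a₁ / θ₁ + a₂ + a₃ * θ₂ + a₄) * this
  rw [h6]
  have h7 : 0 ≤ a₄ * √(T : ℝ) := by positivity
  have h8 : 0 ≤ (a₁ / θ₁ + a₂ + a₃ * θ₂) * (T * s) := by positivity
  linarith

end MinExpectation

/-! ### Estimates along a run -/

section Run

variable {n m : ℕ} {Ω Ξ : Type*} [MeasurableSpace Ω] [MeasurableSpace Ξ]
  {P : Measure Ω} [IsProbabilityMeasure P] {D : Measure Ξ} [IsProbabilityMeasure D]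
  {gradK : Mat n m → Mat n m} {β₁ β₂ lam η : ℝ} {X₀ M₀ : Mat n m} {ℓ : Mat n m → Ξ → ℝ}
  {ξ : ℕ → Ω → Ξ} {X M M' : ℕ → Ω → Mat n m} {F : Mat n m → ℝ}

/-- The quantitative facts about a run that the convergence estimates use: `N` bounds the noise,
`W` the distance of the momenta from `-∇F`, and `c` the length of the steps. -/
structure IsControlledRun (F : Mat n m → ℝ) (gradK : Mat n m → Mat n m) (lam η c b₀ b₁ s : ℝ)
    (P : Measure Ω) (X M M' : ℕ → Ω → Mat n m) (N W : ℕ → Ω → ℝ) : Prop where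
  measurable_X : ∀ t, Measurable (X t)
  integrable_M : ∀ t, Integrable (M t) P
  integrable_M' : ∀ t, Integrable (M' (t + 1)) P
  measurable_M : ∀ t, Measurable (M t)
  measurable_M' : ∀ t, Measurable (M' (t + 1))
  integrable_noise : ∀ t, Integrable (N t) P
  integral_noise_le : ∀ t, ∫ ω, N t ω ∂P ≤ s
  norm_M'_add_gradient_le : ∀ t ω, ‖M' (t + 1) ω + gradient F (X t ω)‖ ≤ W t ω
  norm_M'_sub_M_le : ∀ t ω, ‖M' (t + 1) ω - M (t + 1) ω‖ ≤ W t ω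
  sum_W_le : ∀ T ω, ∑ t ∈ Finset.range T, W t ω ≤
    b₀ + T * (b₁ * η) + 2 * ∑ t ∈ Finset.range T, N t ω
  norm_step_le : ∀ t ω, ‖gradK (M' (t + 1) ω) - lam • X (t + 1) ω‖ ≤ c
  norm_X_le : ∀ t ω, ‖lam • X t ω‖ ≤ c

/-- Only measurability and boundedness of the update map enter, so this serves subgradient
selections and the matrix sign alike. -/
theorem IsRun.exists_isControlledRun {L R s : ℝ}
    (h : IsRun gradK β₁ β₂ lam η X₀ M₀ ℓ ξ X M M') (hgradK : Measurable gradK)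
    (hR : ∀ Y, ‖gradK Y‖ ≤ R) (hL0 : 0 ≤ L)
    (hL : ∀ X Y, ‖gradient F Y - gradient F X‖ ≤ L * ‖Y - X‖)
    (hβ₁ : 0 < β₁) (hβ : β₁ < β₂) (hβ₂ : β₂ < 1) (hlam : 0 < lam) (hη : 0 < η) {v : ℝ}
    (hmodel : IsStochasticModel F D ℓ v) (hξ : IsIIDSample P D ξ) (hs : √v ≤ s) :
    ∃ N W, IsControlledRun F gradK lam η (‖lam • X₀‖ + 2 * R) (‖M₀ + gradient F X₀‖ / (1 - β₂))
      (L * (‖lam • X₀‖ + 2 * R) / (1 - β₂)) s P X M M' N W := by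
  set c := ‖lam • X₀‖ + 2 * R with hc
  have hR0 : 0 ≤ R := (norm_nonneg _).trans (hR 0)
  have hG := measurable_stochGrad hmodel.measurable_loss hmodel.differentiable_loss
  have hFcont : Continuous (gradient F) :=
    (LipschitzWith.of_dist_le_mul (K := ⟨L, hL0⟩) fun x y => by
      rw [dist_eq_norm, dist_eq_norm]; exact hL y x).continuous
  have hpast := h.measurable_past hgradK hG (mul_pos hη hlam)
  have hXm : ∀ t, Measurable (X t) := fun t =>
    (hpast t).1.mono (past_le hξ.measurable t) le_rfl
  have hMm : ∀ t, Measurable (M t) := fun t =>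
    (hpast t).2.mono (past_le hξ.measurable t) le_rfl
  let G : ℕ → Ω → Mat n m := fun t ω => stochGrad ℓ (X t ω) (ξ t ω)
  let q : ℕ → Ω → Mat n m := fun t ω => gradient F (X t ω)
  have hGm : ∀ t, Measurable (G t) := fun t => hG.comp ((hXm t).prodMk (hξ.measurable t))
  have hqm : ∀ t, Measurable (q t) := fun t => hFcont.measurable.comp (hXm t)
  have hM'm : ∀ t, Measurable (M' (t + 1)) := fun t => by
    rw [funext (h.step_M' t)]
    exact ((hMm t).const_smul β₁).sub ((hGm t).const_smul (1 - β₁))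
  have hXb : ∀ t ω, ‖lam • X t ω‖ ≤ ‖lam • X₀‖ + R := fun t ω => by
    have := norm_smul_le_of_implicit_step (x := fun t => X t ω)
      (v := fun t => gradK (M' t ω)) hlam hη (fun t => h.step_X t ω) (fun t => hR _) t
    simpa [h.init_X] using this
  have hd : ∀ t ω, ‖gradK (M' (t + 1) ω) - lam • X (t + 1) ω‖ ≤ c := fun t ω => by
    refine (norm_sub_le _ _).trans ?_
    linarith [hR (M' (t + 1) ω), hXb (t + 1) ω]
  have hq : ∀ t ω, ‖q (t + 1) ω - q t ω‖ ≤ L * (c * η) := fun t ω => by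
    refine (hL _ _).trans (mul_le_mul_of_nonneg_left ?_ hL0)
    rw [h.step_X t ω, add_sub_cancel_left, norm_smul, Real.norm_of_nonneg hη.le, mul_comm c]
    exact mul_le_mul_of_nonneg_left (hd t ω) hη.le
  have hlint : ∀ t, ∫⁻ ω, ‖G t ω - q t ω‖ₑ ∂P ≤ ENNReal.ofReal s := fun t =>
    (lintegral_noise_comp_le hmodel hFcont hξ (hpast t).1).trans (ENNReal.ofReal_le_ofReal hs)
  have hnoise : ∀ t, Integrable (fun ω => G t ω - q t ω) P := fun t =>
    ⟨((hGm t).sub (hqm t)).aestronglyMeasurable, (hlint t).trans_lt ENNReal.ofReal_lt_top⟩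
  -- The iterates are bounded surely, hence so are the gradients along the run; integrability of the
  -- sampled gradients and of the momenta follows.
  have hqint : ∀ t, Integrable (q t) P := by
    intro t
    refine Integrable.of_bound (hqm t).aestronglyMeasurable
      (‖gradient F 0‖ + L * ((‖lam • X₀‖ + R) / lam)) (.of_forall fun ω => ?_)
    have h1 := hL 0 (X t ω)
    have h2 := norm_sub_norm_le (q t ω) (gradient F 0)
    have h3 : ‖X t ω - 0‖ ≤ (‖lam • X₀‖ + R) / lam := by
      rw [sub_zero, le_div_iff₀ hlam, mul_comm]
      simpa [norm_smul, abs_of_pos hlam] using hXb t ω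
    have h4 := mul_le_mul_of_nonneg_left h3 hL0
    linarith
  have hGint : ∀ t, Integrable (G t) P := fun t =>
    ((hnoise t).add (hqint t)).congr (.of_forall fun ω => sub_add_cancel _ _)
  have hMint : ∀ t, Integrable (M t) P := by
    intro t
    induction t with
    | zero => rw [funext h.init_M]; exact integrable_const _
    | succ t ih =>
      rw [funext (h.step_M t)]
      exact (ih.smul β₂).sub ((hGint t).smul (1 - β₂))
  -- `N` is the noise and `W` is momentum error plus noise; the latter also bounds `M' - M` because
  -- `|β₁ - β₂| ≤ 1`.
  refine ⟨fun t ω => ‖G t ω - q t ω‖, fun t ω => ‖M t ω + q t ω‖ + ‖G t ω - q t ω‖, hXm, hMint,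
    fun t => ?_, hMm, hM'm, fun t => (hnoise t).norm, fun t => ?_, fun t ω => ?_, fun t ω => ?_,
    fun T ω => ?_, hd, fun t ω => (hXb t ω).trans (by linarith)⟩
  · rw [funext (h.step_M' t)]
    exact ((hMint t).smul β₁).sub ((hGint t).smul (1 - β₁))
  · rw [integral_norm_eq_lintegral_enorm (hnoise t).aestronglyMeasurable]
    exact ENNReal.toReal_le_of_le_ofReal ((Real.sqrt_nonneg v).trans hs) (hlint t)
  · rw [h.step_M' t ω]
    exact norm_interpolated_momentum_add_le hβ₁.le (hβ.trans hβ₂).le _ _ _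
  · have h1 : M' (t + 1) ω - M (t + 1) ω =
        (β₁ - β₂) • ((M t ω + q t ω) + (G t ω - q t ω)) := by
      rw [h.step_M' t ω, h.step_M t ω]
      module
    rw [h1, norm_smul]
    refine (mul_le_of_le_one_left (norm_nonneg _) ?_).trans (norm_add_le _ _)
    rw [Real.norm_eq_abs, abs_le]
    constructor <;> linarith
  · have := sum_momentum_error_le (hβ₁.trans hβ).le hβ₂ (q := fun t => q t ω)
      (m := fun t => M t ω) (g := fun t => G t ω) (fun t => h.step_M t ω) (fun t => hq t ω) T
    refine this.trans (le_of_eq ?_)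
    simp only [q, h.init_M, h.init_X]
    ring

namespace IsControlledRun

variable {c b₀ b₁ s Fmin L R θ₁ θ₂ : ℝ} {N W : ℕ → Ω → ℝ}

omit [IsProbabilityMeasure P] in
theorem measurable_step (h : IsControlledRun F gradK lam η c b₀ b₁ s P X M M' N W)
    (hgradK : Measurable gradK) (t : ℕ) :
    Measurable fun ω => gradK (M' (t + 1) ω) - lam • X (t + 1) ω :=
  (hgradK.comp (h.measurable_M' t)).sub ((h.measurable_X (t + 1)).const_smul lam)

omit [IsProbabilityMeasure P] in
theorem integrable_inner_step (h : IsControlledRun F gradK lam η c b₀ b₁ s P X M M' N W)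
    (hgradK : Measurable gradK) (t : ℕ) :
    Integrable (fun ω => inner ℝ (gradK (M' (t + 1) ω) - lam • X (t + 1) ω) (M' (t + 1) ω)) P := by
  refine ((h.integrable_M' t).norm.const_mul c).mono'
    ((h.measurable_step hgradK t).inner (h.measurable_M' t)).aestronglyMeasurable
    (.of_forall fun ω => ?_)
  exact (norm_inner_le_norm _ _).trans
    (mul_le_mul_of_nonneg_right (h.norm_step_le t ω) (norm_nonneg _))

omit [MeasurableSpace Ξ] [IsProbabilityMeasure P] in
theorem sum_inner_step_le (h : IsControlledRun F gradK lam η c b₀ b₁ s P X M M' N W)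
    (hrun : IsRun gradK β₁ β₂ lam η X₀ M₀ ℓ ξ X M M')
    (hF : Differentiable ℝ F) (hL0 : 0 ≤ L)
    (hL : ∀ X Y, ‖gradient F Y - gradient F X‖ ≤ L * ‖Y - X‖) (hmin : ∀ X, Fmin ≤ F X)
    (hη : 0 < η) (hc : 0 ≤ c) (T : ℕ) (ω : Ω) :
    ∑ t ∈ Finset.range T, inner ℝ (gradK (M' (t + 1) ω) - lam • X (t + 1) ω) (M' (t + 1) ω) ≤
      (F X₀ - Fmin) / η + c * b₀ + T * ((L * c ^ 2 + c * b₁) * η) +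
        2 * c * ∑ t ∈ Finset.range T, N t ω := by
  have h1 := LionK.sum_inner_step_le hF hL0 hL hmin hη (x := fun t => X t ω)
    (d := fun t => gradK (M' t ω) - lam • X t ω) (m' := fun t => M' t ω) (W := fun t => W t ω)
    (fun t => hrun.step_X t ω) (fun t => h.norm_step_le t ω)
    (fun t => h.norm_M'_add_gradient_le t ω) T
  rw [hrun.init_X] at h1
  have h2 := mul_le_mul_of_nonneg_left (h.sum_W_le T ω) hc
  linarith

omit [MeasurableSpace Ξ] in
/-- Convergence of the primal-dual gap of the implicit step. -/
theorem minExpectationBound_gap (K : Seminorm ℝ (Mat n m))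
    (h : IsControlledRun F gradK lam η c b₀ b₁ s P X M M' N W)
    (hrun : IsRun gradK β₁ β₂ lam η X₀ M₀ ℓ ξ X M M') (hgradK_meas : Measurable gradK)
    (hgradK : ∀ X, IsSubgradient (fun Y => (K Y : EReal)) X (gradK X))
    {gradKstar : Mat n m → Mat n m}
    (hgradKstar : ∀ X, conjugate K X < ⊤ → IsSubgradient (conjugate K) X (gradKstar X))
    (hX₀ : conjugate K (lam • X₀) < ⊤)
    (hF : Differentiable ℝ F) (hL0 : 0 ≤ L)
    (hL : ∀ X Y, ‖gradient F Y - gradient F X‖ ≤ L * ‖Y - X‖) (hmin : ∀ X, Fmin ≤ F X)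
    (hlam : 0 < lam) (hc : 0 ≤ c) (hb₀ : 0 ≤ b₀) (hb₁ : 0 ≤ b₁) (hs : 0 ≤ s) {T : ℕ} (hT : 1 ≤ T)
    (hθ₁ : 0 < θ₁) (hη : 0 < η) (hη₁ : θ₁ / √(T : ℝ) ≤ η) (hη₂ : η ≤ θ₂ / √(T : ℝ)) :
    MinExpectationBound P
      (fun t ω => inner ℝ (gradK (M' t ω) - lam • X t ω) (M' t ω - gradKstar (lam • X t ω))) T hT
      (((F X₀ - Fmin) / θ₁ + c * b₀ + (L * c ^ 2 + c * b₁) * θ₂ + 2 * c) *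
        (1 / √(T : ℝ) + s)) := by
  have hB : ∀ t ω, lam • X t ω ∈ dualBall K := fun t ω =>
    smul_mem_of_implicit_step hlam hη (convex_dualBall K) (x := fun t => X t ω)
      (v := fun t => gradK (M' t ω)) (fun t => hrun.step_X t ω)
      (fun t => subgradient_mem_dualBall K (hgradK _))
      (by simpa only [hrun.init_X] using mem_dualBall_of_conjugate_lt_top K hX₀) t
  -- Removing `gradKstar` here is also what yields integrability, as no measurability of that
  -- selection is available.
  have hQ : ∀ t ω, inner ℝ (gradK (M' (t + 1) ω) - lam • X (t + 1) ω)
      (M' (t + 1) ω - gradKstar (lam • X (t + 1) ω)) =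
      inner ℝ (gradK (M' (t + 1) ω) - lam • X (t + 1) ω) (M' (t + 1) ω) := fun t ω =>
    inner_implicit_step_sub_subgradient K hlam hη (hrun.step_X t ω) (hB t ω) (hB (t + 1) ω)
      (subgradient_mem_dualBall K (hgradK _))
      (hgradKstar _ (by rw [conjugate_eq_zero K (hB _ _)]; exact EReal.zero_lt_top))
  refine minExpectationBound_of_sum_le hT hθ₁ hη₁ hη₂ (sub_nonneg.mpr (hmin X₀)) (by positivity)
    (by positivity) (by positivity) hs (fun t => ?_) (fun t ω => ?_) h.integrable_noise
    h.integral_noise_le (fun ω => ?_)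
  · simp_rw [hQ]
    exact h.integrable_inner_step hgradK_meas t
  · rw [hQ, inner_sub_left, inner_subgradient_self K (hgradK _)]
    exact sub_nonneg.mpr (hB _ _ _)
  · simp_rw [hQ]
    exact h.sum_inner_step_le hrun hF hL0 hL hmin hη hc T ω

/-- Convergence of the monotonicity gap between the two momenta. -/
theorem minExpectationBound_momentum {K : Mat n m → ℝ}
    (h : IsControlledRun F gradK lam η c b₀ b₁ s P X M M' N W) (hgradK_meas : Measurable gradK)
    (hgradK : ∀ X, IsSubgradient (fun Y => (K Y : EReal)) X (gradK X))
    (hR : ∀ Y, ‖gradK Y‖ ≤ R) (hb₀ : 0 ≤ b₀) (hb₁ : 0 ≤ b₁) (hs : 0 ≤ s) {T : ℕ} (hT : 1 ≤ T)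
    (hθ₁ : 0 < θ₁) (hη₁ : θ₁ / √(T : ℝ) ≤ η) (hη₂ : η ≤ θ₂ / √(T : ℝ)) :
    MinExpectationBound P
      (fun t ω => inner ℝ (gradK (M' t ω) - gradK (M t ω)) (M' t ω - M t ω)) T hT
      ((2 * R * b₀ + 2 * R * b₁ * θ₂ + 4 * R) * (1 / √(T : ℝ) + s)) := by
  have hR0 : 0 ≤ R := (norm_nonneg _).trans (hR 0)
  have hle : ∀ Y Z, ‖gradK Y - gradK Z‖ ≤ 2 * R := fun Y Z =>
    (norm_sub_le _ _).trans (by linarith [hR Y, hR Z])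
  -- No descent of `F` is involved, so the coefficient of `1/η` is `0`.
  rw [show 2 * R * b₀ = 0 / θ₁ + 2 * R * b₀ by rw [zero_div, zero_add]]
  refine minExpectationBound_of_sum_le hT hθ₁ hη₁ hη₂ le_rfl (by positivity)
    (by positivity) (by positivity) hs (fun t => ?_) (fun t ω => ?_) h.integrable_noise
    h.integral_noise_le (fun ω => ?_)
  · have hm1 : Measurable fun ω => gradK (M' (t + 1) ω) - gradK (M (t + 1) ω) :=
      (hgradK_meas.comp (h.measurable_M' t)).sub (hgradK_meas.comp (h.measurable_M (t + 1)))
    have hi := (h.integrable_M' t).sub (h.integrable_M (t + 1))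
    refine (hi.norm.const_mul (2 * R)).mono'
      (hm1.inner ((h.measurable_M' t).sub (h.measurable_M (t + 1)))).aestronglyMeasurable
      (.of_forall fun ω => ?_)
    exact (norm_inner_le_norm _ _).trans (mul_le_mul_of_nonneg_right (hle _ _) (norm_nonneg _))
  · exact subgradient_monotone (hgradK _) (hgradK _)
  · have h1 : ∀ t ∈ Finset.range T, inner ℝ (gradK (M' (t + 1) ω) - gradK (M (t + 1) ω))
        (M' (t + 1) ω - M (t + 1) ω) ≤ 2 * R * W t ω := fun t _ =>
      (real_inner_le_norm _ _).trans (mul_le_mul (hle _ _) (h.norm_M'_sub_M_le t ω)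
        (norm_nonneg _) (by positivity))
    refine (Finset.sum_le_sum h1).trans ?_
    rw [← Finset.mul_sum, zero_div]
    have h2 := mul_le_mul_of_nonneg_left (h.sum_W_le T ω) (by positivity : 0 ≤ 2 * R)
    linarith

end IsControlledRun

/-! ### The Muon case -/

theorem mem_dualBall_nuclearNorm {A : Mat n m} (hA : ∀ w, ‖toLin A w‖ ≤ ‖w‖) :
    A ∈ dualBall (nuclearNorm : Mat n m → ℝ) := inner_le_nuclearNorm hA

theorem msgn_mem_dualBall (X : Mat n m) : msgn X ∈ dualBall (nuclearNorm : Mat n m → ℝ) :=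
  mem_dualBall_nuclearNorm (norm_toLin_msgn_le X)

theorem toLin_neg (X : Mat n m) : toLin (-X) = -toLin X := by
  have : toMatrix (-X) = -toMatrix X := rfl
  rw [toLin, this, map_neg]

theorem norm_msgn_le (X : Mat n m) : ‖msgn X‖ ≤ m :=
  norm_le_of_mem_dualBall m.cast_nonneg nuclearNorm_le (msgn_mem_dualBall X)

/-- `msgn X` attains the nuclear norm at `X` and is an admissible test matrix at `Y`. -/
theorem nuclearNorm_le_add (X Y : Mat n m) : nuclearNorm X ≤ nuclearNorm Y + m * ‖X - Y‖ := by
  have h1 : nuclearNorm X = inner ℝ (msgn X) Y + inner ℝ (msgn X) (X - Y) := by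
    rw [← inner_add_right, add_sub_cancel, inner_msgn_self]
  have h2 : inner ℝ (msgn X) (X - Y) ≤ m * ‖X - Y‖ := (real_inner_le_norm _ _).trans
    (mul_le_mul_of_nonneg_right (norm_msgn_le X) (norm_nonneg _))
  linarith [msgn_mem_dualBall X Y]

theorem continuous_nuclearNorm : Continuous (nuclearNorm : Mat n m → ℝ) :=
  (LipschitzWith.of_le_add_mul (m : NNReal) fun X Y => by
    rw [dist_eq_norm]; exact nuclearNorm_le_add X Y).continuous

/-- The nuclear norm is even because `-msgn (-Y)` is a contraction, so its dual ball is symmetric.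
-/
theorem neg_mem_dualBall_nuclearNorm {X : Mat n m}
    (hX : X ∈ dualBall (nuclearNorm : Mat n m → ℝ)) :
    -X ∈ dualBall (nuclearNorm : Mat n m → ℝ) := by
  have hle : ∀ Y : Mat n m, nuclearNorm (-Y) ≤ nuclearNorm Y := fun Y => by
    have h1 : -msgn (-Y) ∈ dualBall (nuclearNorm : Mat n m → ℝ) :=
      mem_dualBall_nuclearNorm fun w => by
        rw [toLin_neg, LinearMap.neg_apply, norm_neg]
        exact norm_toLin_msgn_le (-Y) w
    have h2 := h1 Y
    rwa [inner_neg_left, ← inner_neg_right, inner_msgn_self] at h2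
  intro Y
  have h1 := hX (-Y)
  rw [inner_neg_right, ← inner_neg_left] at h1
  exact h1.trans (hle Y)

theorem kktScore_nonneg (F : Mat n m → ℝ) {X : Mat n m}
    (hX : lam • X ∈ dualBall (nuclearNorm : Mat n m → ℝ)) : 0 ≤ kktScore F lam X := by
  have h := neg_mem_dualBall_nuclearNorm hX (gradient F X)
  rw [inner_neg_left] at h
  rw [kktScore]
  linarith

/-- Replacing `∇F(X)` by `-Z` costs `m` in the nuclear norm and `c` in the linear term, per unit of
distance. The momentum `M'` is inserted for `Z` in the descent estimate, and `Z = 0` gives the bound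
used for integrability. -/
theorem kktScore_le (F : Mat n m → ℝ) {X Z : Mat n m} {c : ℝ} (hX : ‖lam • X‖ ≤ c) :
    kktScore F lam X ≤ inner ℝ (msgn Z - lam • X) Z + (m + c) * ‖Z + gradient F X‖ := by
  set q := gradient F X
  have h1 : nuclearNorm q = inner ℝ (-msgn q) Z + inner ℝ (msgn q) (Z + q) := by
    rw [inner_neg_left, inner_add_right, inner_msgn_self]; ring
  have h2 := neg_mem_dualBall_nuclearNorm (msgn_mem_dualBall q) Z
  have h3 : inner ℝ (msgn q) (Z + q) ≤ m * ‖Z + q‖ := (real_inner_le_norm _ _).trans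
    (mul_le_mul_of_nonneg_right (norm_msgn_le q) (norm_nonneg _))
  have h4 : inner ℝ (lam • X) (Z + q) ≤ c * ‖Z + q‖ := (real_inner_le_norm _ _).trans
    (mul_le_mul_of_nonneg_right hX (norm_nonneg _))
  rw [inner_add_right] at h4
  rw [kktScore, inner_sub_left, inner_msgn_self]
  linarith

omit [MeasurableSpace Ξ] in
/-- Convergence of the KKT score for the matrix sign. -/
theorem IsControlledRun.minExpectationBound_kktScore {c b₀ b₁ s Fmin L θ₁ θ₂ : ℝ}
    {N W : ℕ → Ω → ℝ} (h : IsControlledRun F msgn lam η c b₀ b₁ s P X M M' N W)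
    (hrun : IsRun msgn β₁ β₂ lam η X₀ M₀ ℓ ξ X M M') (hX₀ : spectralNorm (lam • X₀) ≤ 1)
    (hF : Differentiable ℝ F) (hL0 : 0 ≤ L)
    (hL : ∀ X Y, ‖gradient F Y - gradient F X‖ ≤ L * ‖Y - X‖) (hmin : ∀ X, Fmin ≤ F X)
    (hlam : 0 < lam) (hc : 0 ≤ c) (hb₀ : 0 ≤ b₀) (hb₁ : 0 ≤ b₁) (hs : 0 ≤ s) {T : ℕ} (hT : 1 ≤ T)
    (hθ₁ : 0 < θ₁) (hη : 0 < η) (hη₁ : θ₁ / √(T : ℝ) ≤ η) (hη₂ : η ≤ θ₂ / √(T : ℝ)) :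
    MinExpectationBound P (fun t ω => kktScore F lam (X t ω)) T hT
      (((F X₀ - Fmin) / θ₁ + (m + 2 * c) * b₀ +
        (L * c ^ 2 + c * b₁ + (m + c) * (b₁ + L * c)) * θ₂ + 2 * (m + 2 * c)) *
        (1 / √(T : ℝ) + s)) := by
  have hB : ∀ t ω, lam • X t ω ∈ dualBall (nuclearNorm : Mat n m → ℝ) := fun t ω =>
    smul_mem_of_implicit_step hlam hη (convex_dualBall _) (x := fun t => X t ω)
      (v := fun t => msgn (M' t ω)) (fun t => hrun.step_X t ω)
      (fun t => msgn_mem_dualBall _)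
      (by
        simp only [hrun.init_X]
        exact mem_dualBall_nuclearNorm fun w => (norm_toLin_le _ w).trans
          (mul_le_of_le_one_left (norm_nonneg w) hX₀)) t
  have hFcont : Continuous (gradient F) :=
    (LipschitzWith.of_dist_le_mul (K := ⟨L, hL0⟩) fun x y => by
      rw [dist_eq_norm, dist_eq_norm]; exact hL y x).continuous
  -- The score is taken at the new iterate whereas `W` refers to the old one; the step between them
  -- moves the gradient by at most `L c η`.
  have herr : ∀ t ω, ‖M' (t + 1) ω + gradient F (X (t + 1) ω)‖ ≤ W t ω + L * c * η := by
    intro t ω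
    have h1 : M' (t + 1) ω + gradient F (X (t + 1) ω) = (M' (t + 1) ω + gradient F (X t ω)) +
        (gradient F (X (t + 1) ω) - gradient F (X t ω)) := by abel
    rw [h1]
    refine (norm_add_le _ _).trans (add_le_add (h.norm_M'_add_gradient_le t ω) ?_)
    refine (hL _ _).trans ?_
    rw [mul_assoc]
    refine mul_le_mul_of_nonneg_left ?_ hL0
    rw [hrun.step_X t ω, add_sub_cancel_left, norm_smul, Real.norm_of_nonneg hη.le, mul_comm c]
    exact mul_le_mul_of_nonneg_left (h.norm_step_le t ω) hη.le
  have hkkt : ∀ t ω, kktScore F lam (X (t + 1) ω) ≤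
      inner ℝ (msgn (M' (t + 1) ω) - lam • X (t + 1) ω) (M' (t + 1) ω) +
        (m + c) * (W t ω + L * c * η) := fun t ω =>
    (kktScore_le F (h.norm_X_le (t + 1) ω)).trans
      (add_le_add_right (mul_le_mul_of_nonneg_left (herr t ω) (by positivity)) _)
  refine minExpectationBound_of_sum_le hT hθ₁ hη₁ hη₂ (sub_nonneg.mpr (hmin X₀)) (by positivity)
    (by positivity) (by positivity) hs (fun t => ?_) (fun t ω => kktScore_nonneg F (hB _ _))
    h.integrable_noise h.integral_noise_le (fun ω => ?_)
  · have hcont : Continuous (kktScore F lam) :=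
      (continuous_nuclearNorm.comp hFcont).add
        ((continuous_const_smul lam).inner hFcont)
    refine Integrable.of_bound (hcont.measurable.comp (h.measurable_X _)).aestronglyMeasurable
      ((m + c) * (‖gradient F 0‖ + L * (c / lam))) (.of_forall fun ω => ?_)
    have h1 := hL 0 (X (t + 1) ω)
    have h2 := norm_sub_norm_le (gradient F (X (t + 1) ω)) (gradient F 0)
    have h3 : ‖X (t + 1) ω - 0‖ ≤ c / lam := by
      rw [sub_zero, le_div_iff₀ hlam, mul_comm]
      simpa [norm_smul, abs_of_pos hlam] using h.norm_X_le (t + 1) ω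
    have h4 := mul_le_mul_of_nonneg_left h3 hL0
    have h5 : ‖gradient F (X (t + 1) ω)‖ ≤ ‖gradient F 0‖ + L * (c / lam) := by linarith
    have h6 := kktScore_le F (Z := 0) (h.norm_X_le (t + 1) ω)
    rw [inner_zero_right, zero_add, zero_add] at h6
    rw [Real.norm_of_nonneg (kktScore_nonneg F (hB _ _))]
    exact h6.trans (mul_le_mul_of_nonneg_left h5 (by positivity))
  · have h1 := Finset.sum_le_sum fun t (_ : t ∈ Finset.range T) => hkkt t ω
    rw [Finset.sum_add_distrib, ← Finset.mul_sum, Finset.sum_add_distrib, Finset.sum_const,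
      Finset.card_range, nsmul_eq_mul] at h1
    have h2 := h.sum_inner_step_le hrun hF hL0 hL hmin hη hc T ω
    have h3 := mul_le_mul_of_nonneg_left (h.sum_W_le T ω) (by positivity : 0 ≤ m + c)
    linarith

end Run

end LionK

/-! ### Assembly of the uniform constant. -/

theorem mainTheorem3 {n m : ℕ}
    -- the objective: it attains its minimum and is `L`-smooth
    (F : LionK.Mat n m → ℝ) (L : ℝ)
    (hmin : ∃ Xstar, ∀ X, F Xstar ≤ F X)
    (hsmooth : LionK.IsLSmooth F L)
    -- the norm `K`, a (measurable) choice `gradK` of its subgradients, and a choice `gradKstar` of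
    -- subgradients of the conjugate of `K` on its effective domain
    (K : Seminorm ℝ (LionK.Mat n m)) (hK : ∀ X, K X = 0 → X = 0)
    (gradK : LionK.Mat n m → LionK.Mat n m) (hgradK_meas : Measurable gradK)
    (hgradK : ∀ X, LionK.IsSubgradient (fun Y => (K Y : EReal)) X (gradK X))
    (gradKstar : LionK.Mat n m → LionK.Mat n m)
    (hgradKstar : ∀ X, LionK.conjugate K X < ⊤ →
      LionK.IsSubgradient (LionK.conjugate K) X (gradKstar X))
    -- the parameters, the initial point, and the constants in `η = Θ(1 / √T)`
    (β₁ β₂ lam : ℝ) (hβ₁ : 0 < β₁) (hβ : β₁ < β₂) (hβ₂ : β₂ < 1) (hlam : 0 < lam)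
    (X₀ M₀ : LionK.Mat n m)
    (θ₁ θ₂ : ℝ) (hθ₁ : 0 < θ₁) :
    ∃ C : ℝ, ∀ (σ : ℝ) (nbatch : ℕ), 0 ≤ σ → 1 ≤ nbatch →
      ∀ (Ξ : Type*) [MeasurableSpace Ξ] (D : Measure Ξ) [IsProbabilityMeasure D]
        (ℓ : LionK.Mat n m → Ξ → ℝ), LionK.IsStochasticModel F D ℓ (σ ^ 2 / nbatch) →
      ∀ (Ω : Type*) [MeasurableSpace Ω] (P : Measure Ω) [IsProbabilityMeasure P]
        (ξ : ℕ → Ω → Ξ), LionK.IsIIDSample P D ξ →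
      ∀ (T : ℕ) (hT : 1 ≤ T) (η : ℝ), θ₁ / √(T : ℝ) ≤ η → η ≤ θ₂ / √(T : ℝ) →
      ∀ X M M' : ℕ → Ω → LionK.Mat n m,
        (LionK.IsRun gradK β₁ β₂ lam η X₀ M₀ ℓ ξ X M M' →
          (LionK.conjugate K (lam • X₀) < ⊤ →
            LionK.MinExpectationBound P
              (fun t ω => inner ℝ (gradK (M' t ω) - lam • X t ω)
                (M' t ω - gradKstar (lam • X t ω)))
              T hT (C * (1 / √(T : ℝ) + σ / √(nbatch : ℝ)))) ∧
          LionK.MinExpectationBound P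
            (fun t ω => inner ℝ (gradK (M' t ω) - gradK (M t ω)) (M' t ω - M t ω))
            T hT (C * (1 / √(T : ℝ) + σ / √(nbatch : ℝ)))) ∧
        (LionK.IsRun LionK.msgn β₁ β₂ lam η X₀ M₀ ℓ ξ X M M' →
          LionK.spectralNorm (lam • X₀) ≤ 1 →
            LionK.MinExpectationBound P (fun t ω => LionK.kktScore F lam (X t ω))
              T hT (C * (1 / √(T : ℝ) + σ / √(nbatch : ℝ)))) := by
  
  obtain ⟨Xstar, hXstar⟩ := hmin
  obtain ⟨hF, hL'⟩ := hsmooth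
  -- The sign of `L` is not prescribed; `|L|` is a valid nonnegative Lipschitz constant.
  have hL : ∀ X Y, ‖gradient F Y - gradient F X‖ ≤ |L| * ‖Y - X‖ := fun X Y =>
    (hL' X Y).trans (mul_le_mul_of_nonneg_right (le_abs_self L) (norm_nonneg _))
  obtain ⟨R, hR0, hR⟩ := LionK.exists_seminorm_le K
  have hgradK_norm : ∀ Y, ‖gradK Y‖ ≤ R := fun Y =>
    LionK.norm_le_of_mem_dualBall hR0 hR (LionK.subgradient_mem_dualBall K (hgradK Y))
  -- For `θ₂ < θ₁` no admissible `η` exists and any constant works.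
  rcases lt_or_ge θ₂ θ₁ with hθ | hθ
  · refine ⟨0, fun σ nbatch _ _ Ξ _ D _ ℓ _ Ω _ P _ ξ _ T hT η hη₁ hη₂ => ?_⟩
    have hr : 0 < √(T : ℝ) := Real.sqrt_pos.mpr (by exact_mod_cast hT)
    exact absurd ((div_le_div_iff_of_pos_right hr).mp (hη₁.trans hη₂)) (not_le.mpr hθ)
  have hθ₂ : 0 ≤ θ₂ := hθ₁.le.trans hθ
  have hb : 0 < 1 - β₂ := sub_pos.mpr hβ₂
  have hgap : 0 ≤ F X₀ - F Xstar := sub_nonneg.mpr (hXstar X₀)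
  have hL0 := abs_nonneg L
  set b₀ := ‖M₀ + gradient F X₀‖ / (1 - β₂) with hb₀
  have hb₀0 : 0 ≤ b₀ := by positivity
  set c := ‖lam • X₀‖ + 2 * R with hc
  have hc0 : 0 ≤ c := by positivity
  -- The matrix sign has Frobenius norm at most `m`, which takes the place of `R`.
  set c' := ‖lam • X₀‖ + 2 * (m : ℝ) with hc'
  have hc'0 : 0 ≤ c' := by positivity
  set b₁ := |L| * c / (1 - β₂) with hb₁
  have hb₁0 : 0 ≤ b₁ := by positivity
  set b₁' := |L| * c' / (1 - β₂) with hb₁'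
  have hb₁'0 : 0 ≤ b₁' := by positivity
  set C₁ := (F X₀ - F Xstar) / θ₁ + c * b₀ + (|L| * c ^ 2 + c * b₁) * θ₂ + 2 * c with hC₁
  have hC₁0 : 0 ≤ C₁ := by positivity
  set C₂ := 2 * R * b₀ + 2 * R * b₁ * θ₂ + 4 * R with hC₂
  have hC₂0 : 0 ≤ C₂ := by positivity
  set C₃ := (F X₀ - F Xstar) / θ₁ + (m + 2 * c') * b₀ +
    (|L| * c' ^ 2 + c' * b₁' + (m + c') * (b₁' + |L| * c')) * θ₂ + 2 * (m + 2 * c') with hC₃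
  have hC₃0 : 0 ≤ C₃ := by positivity
  refine ⟨C₁ + C₂ + C₃, fun σ nbatch hσ _ Ξ _ D _ ℓ hmodel Ω _ P _ ξ hξ T hT η hη₁ hη₂ X M M' => ?_⟩
  have hr : 0 < √(T : ℝ) := Real.sqrt_pos.mpr (by exact_mod_cast hT)
  have hη : 0 < η := (div_pos hθ₁ hr).trans_le hη₁
  have hs : √(σ ^ 2 / nbatch) ≤ σ / √(nbatch : ℝ) := by
    rw [Real.sqrt_div (sq_nonneg σ), Real.sqrt_sq hσ]
  have hs0 : 0 ≤ σ / √(nbatch : ℝ) := by positivity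
  have hpos : 0 ≤ 1 / √(T : ℝ) + σ / √(nbatch : ℝ) := by positivity
  refine ⟨fun hrun => ?_, fun hrun hX₀ => ?_⟩
  · obtain ⟨N, W, h⟩ := hrun.exists_isControlledRun hgradK_meas hgradK_norm hL0 hL hβ₁ hβ hβ₂ hlam
      hη hmodel hξ hs
    refine ⟨fun hX₀ => ?_, ?_⟩
    · exact (h.minExpectationBound_gap K hrun hgradK_meas hgradK hgradKstar hX₀ hF hL0 hL hXstar
        hlam hc0 hb₀0 hb₁0 hs0 hT hθ₁ hη hη₁ hη₂).mono
        (mul_le_mul_of_nonneg_right (by linarith) hpos)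
    · exact (h.minExpectationBound_momentum hgradK_meas hgradK hgradK_norm hb₀0 hb₁0 hs0 hT hθ₁
        hη₁ hη₂).mono (mul_le_mul_of_nonneg_right (by linarith) hpos)
  · obtain ⟨N, W, h⟩ := hrun.exists_isControlledRun LionK.measurable_msgn LionK.norm_msgn_le hL0 hL
      hβ₁ hβ hβ₂ hlam hη hmodel hξ hs
    exact (h.minExpectationBound_kktScore hrun hX₀ hF hL0 hL hXstar hlam hc'0 hb₀0 hb₁'0 hs0 hT
      hθ₁ hη hη₁ hη₂).mono (mul_le_mul_of_nonneg_right (by linarith) hpos)
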